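/- Let $n\in\mathbb N$, let $a_1,\dots,a_n>0$ with $\sum_{k=1}^n a_k=1$, and let $d_k,\beta_k$ ($1\le k\le n$) be real numbers with $\sum_{k=1}^n a_k d_k^2<1$. Put $\alpha_k=a_1+\dots+a_{k-1}$. Let the real-valued function $P\in L_2[0,1]$ be self-similar with these parameters, i.e. for every $k$ $$P(x)=d_k\,P\!\left(\frac{x-\alpha_k}{a_k}\right)+\beta_k\qquad\text{for almost every }x\in(\alpha_k,\alpha_k+a_k).$$ Assume that the self-similarity is non-arithmetic: there is no $\nu>0$ such that all the numbers $\ln(a_k|d_k|)$ with $d_k\ne0$ are integer multiples of $\nu$. Assume also that $P$ has a positive spectral order $D$, i.e. $D>0$ and $\sum_{k=1}^n(a_k|d_k|)^{D/2}=1$ (terms with $d_k=0$ being $0$). Let $\mathring W_2^1[0,1]$ be the space of absolutely continuous functions $y:[0,1]\to\mathbb C$ with $y'\in L_2[0,1]$ and $y(0)=y(1)=0$. Let $\rho$ be the generalized derivative of $P$, i.e. $\langle\rho,\varphi\rangle=-\int_0^1 P\,\overline{\varphi'}\,dx$ for $\varphi\in\mathring W_2^1[0,1]$. For real $\lambda$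 let $T_\rho(\lambda)$ be the operator from $\mathring W_2^1[0,1]$ to its antidual defined by $$\langle T_\rho(\lambda)y,z\rangle=\int_0^1\bigl\{y'\overline{z'}+\lambda P\,(y'\overline z+y\,\overline{z'})\bigr\}\,dx ,\qquad y,z\in\mathring W_2^1[0,1],$$ and let $\operatorname{ind}T_\rho(\lambda)$ be its negative index of inertia, i.e. the supremum of the dimensions of the finite-dimensional subspaces of $\mathring W_2^1[0,1]$ on which $\langle T_\rho(\lambda)y,y\rangle<0$ for all $y\ne0$. Then $\operatorname{ind}T_\rho(\lambda)$ is finite for every real $\lambda$, and there are real numbers $s_+,s_-\ge0$ such that: 1. $\operatorname{ind}T_\rho(\lambda)=|\lambda|^{D/2}\,(s_++o(1))$ as $\lambda\to+\infty$, and $\operatorname{ind}T_\rho(\lambda)=|\lambda|^{D/2}\,(s_-+o(1))$ as $\lambda\to-\infty$; 2. if $d_k<0$ for some $k$, then $s_+=s_-$; 3. if $\langle\rho,|y|^2\rangle>0$ for some $y\in\mathring W_2^1[0,1]$, then $s_+>0$; if $\langle\rho,|y|^2\rangle<0$ for some $y\in\mathring W_2^1[0,1]$, then $s_->0$. -/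

import Mathlib

open MeasureTheory Filter Topology

noncomputable section

namespace SelfSimilarSL

/-- The space `L_2[0,1]` refers to this measure: Lebesgue measure on `[0,1]`. -/
abbrev unitMeasure : Measure ℝ := volume.restrict (Set.Icc (0 : ℝ) 1)

/-! ### The Sobolev space with zero boundary values -/

/-- A complex-valued absolutely continuous function on `[0,1]` is differentiable almost everywhere
on `[0,1]`. -/
theorem ae_differentiableAt_of_ac {y : ℝ → ℂ} (hy : AbsolutelyContinuousOnInterval y 0 1) :
    ∀ᵐ x ∂unitMeasure, DifferentiableAt ℝ y x := by
  have h := hy.boundedVariationOn.ae_differentiableAt_of_mem_uIcc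
  rw [Set.uIcc_of_le zero_le_one] at h
  rw [ae_restrict_iff' measurableSet_Icc]
  exact h

/-- Functions `y : [0,1] → ℂ` that are absolutely continuous, have `y' ∈ L_2[0,1]` and satisfy
`y(0) = y(1) = 0`, each written as a function on `ℝ` that is zero outside `(0,1)`. -/
def sobolevZero : Submodule ℂ (ℝ → ℂ) where
  carrier := {y | AbsolutelyContinuousOnInterval y 0 1 ∧ MemLp (deriv y) 2 unitMeasure ∧
    ∀ x, x ∉ Set.Ioo (0 : ℝ) 1 → y x = 0}
  zero_mem' := by
    refine ⟨?_, ?_, fun _ _ => rfl⟩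
    · have : LipschitzOnWith 0 (0 : ℝ → ℂ) (Set.uIcc 0 1) := by
        intro x _ y _; simp
      exact this.absolutelyContinuousOnInterval
    · have : deriv (0 : ℝ → ℂ) = 0 := by
        funext x
        exact deriv_const x 0
      rw [this]
      exact MemLp.zero
  add_mem' := by
    rintro y z ⟨hy, hy', hy0⟩ ⟨hz, hz', hz0⟩
    refine ⟨hy.add hz, (hy'.add hz').ae_eq ?_, fun x hx => ?_⟩
    · filter_upwards [ae_differentiableAt_of_ac hy, ae_differentiableAt_of_ac hz] with x h1 h2
      exact (deriv_add h1 h2).symm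
    · simp [hy0 x hx, hz0 x hx]
  smul_mem' := by
    rintro c y ⟨hy, hy', hy0⟩
    refine ⟨hy.const_smul c, (hy'.const_smul c).ae_eq ?_, fun x hx => ?_⟩
    · filter_upwards [ae_differentiableAt_of_ac hy] with x h1
      exact (deriv_const_smul c h1).symm
    · simp [hy0 x hx]

/-- Multiplying an `L_2[0,1]` function by an absolutely continuous one gives an `L_2[0,1]`
function. -/
theorem memLp_mul_of_ac {f g : ℝ → ℂ} (hf : AbsolutelyContinuousOnInterval f 0 1)
    (hg : MemLp g 2 unitMeasure) : MemLp (fun x => f x * g x) 2 unitMeasure := by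
  have hc := hf.continuousOn
  obtain ⟨C, hC⟩ := hf.exists_bound
  rw [Set.uIcc_of_le zero_le_one] at hc hC
  have hb : MemLp f ⊤ unitMeasure := by
    refine memLp_top_of_bound (hc.aestronglyMeasurable measurableSet_Icc) C ?_
    rw [ae_restrict_iff' measurableSet_Icc]
    exact Eventually.of_forall hC
  exact hg.mul hb

/-- The function `|y|²`, again an element of the Sobolev space with zero boundary values. -/
def normSq (y : sobolevZero) : sobolevZero :=
  ⟨fun x => ((‖(y : ℝ → ℂ) x‖ ^ 2 : ℝ) : ℂ), by
    obtain ⟨y, hy, hy', hy0⟩ := y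
    have hs : AbsolutelyContinuousOnInterval (fun x => star (y x)) 0 1 := by
      unfold AbsolutelyContinuousOnInterval at hy ⊢
      simpa only [dist_star_star] using hy
    have hs' : MemLp (fun x => star (deriv y x)) 2 unitMeasure := hy'.star
    have he : (fun x => ((‖y x‖ ^ 2 : ℝ) : ℂ)) = y • fun x => star (y x) := by
      funext x
      simp [Complex.mul_conj']
    refine ⟨?_, ?_, fun x hx => ?_⟩
    · simpa only [he] using hy.smul hs
    · refine ((memLp_mul_of_ac hs hy').add (memLp_mul_of_ac hy hs')).ae_eq ?_
      filter_upwards [ae_differentiableAt_of_ac hy] with x hx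
      have h := hx.hasDerivAt.mul hx.hasDerivAt.star
      have he' : (fun x => ((‖y x‖ ^ 2 : ℝ) : ℂ)) = y * fun x => star (y x) := he
      simp only [he']
      rw [h.deriv]
      simp only [Pi.add_apply]
      ring
    · simp [hy0 x hx]⟩

/-! ### The weight and the operator pencil -/

/-- The generalized derivative `ρ` of `P ∈ L_2[0,1]`, as an antilinear functional on the Sobolev
space: `⟨ρ, φ⟩ = -∫₀¹ P · conj φ'`. -/
def genDeriv (P : ℝ → ℝ) (φ : sobolevZero) : ℂ :=
  -∫ x in (0 : ℝ)..1, (P x : ℂ) * starRingEnd ℂ (deriv (φ : ℝ → ℂ) x)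

/-- The sesquilinear form `⟨T_ρ(lam) y, z⟩` of the pencil of the boundary value problem
`-y'' - lam ρ y = 0`, `y(0) = y(1) = 0`, where `P` is a generalized primitive of `ρ`. -/
def pencil (P : ℝ → ℝ) (lam : ℝ) (y z : sobolevZero) : ℂ :=
  ∫ x in (0 : ℝ)..1,
    (deriv (y : ℝ → ℂ) x * starRingEnd ℂ (deriv (z : ℝ → ℂ) x) +
      (lam : ℂ) * (P x : ℂ) *
        (deriv (y : ℝ → ℂ) x * starRingEnd ℂ ((z : ℝ → ℂ) x) +
          (y : ℝ → ℂ) x * starRingEnd ℂ (deriv (z : ℝ → ℂ) x)))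

/-- The negative index of inertia of a form `F`: the supremum (possibly `⊤`) of the dimensions of
the finite-dimensional subspaces on which the quadratic form `y ↦ F y y` is negative definite. -/
def negIndex {E : Type*} [AddCommGroup E] [Module ℂ E] (F : E → E → ℂ) : ℕ∞ :=
  ⨆ (M : Submodule ℂ E) (_ : FiniteDimensional ℂ M ∧ ∀ y ∈ M, y ≠ 0 → (F y y).re < 0),
    (Module.finrank ℂ M : ℕ∞)

/-- `ind T_ρ(lam)`, where `P` is a generalized primitive of `ρ`. -/
def ind (P : ℝ → ℝ) (lam : ℝ) : ℕ∞ := negIndex (pencil P lam)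

/-! ### Self-similar functions -/

/-- The left end `a_1 + ⋯ + a_{k-1}` of the `k`-th interval of the partition of `[0,1]` into
intervals of lengths `a_1, …, a_n`. -/
def leftEnd {n : ℕ} (a : Fin n → ℝ) (k : Fin n) : ℝ := ∑ j ∈ Finset.Iio k, a j

/-- The similarity operator: on the `k`-th interval of the partition, `f` is replaced by a copy
of `f` compressed to this interval, multiplied by `d_k` and shifted by `β_k`. -/
def similarityOp {n : ℕ} (a d β : Fin n → ℝ) (f : ℝ → ℝ) (x : ℝ) : ℝ :=
  ∑ k, Set.indicator (Set.Ioo (leftEnd a k) (leftEnd a k + a k))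
    (fun t => d k * f ((t - leftEnd a k) / a k) + β k) x

/-- `P ∈ L_2[0,1]` is self-similar with the parameters `a, d, β`: it is the fixed point of the
similarity operator, which is a contraction of `L_2[0,1]`. -/
structure IsSelfSimilar {n : ℕ} (a d β : Fin n → ℝ) (P : ℝ → ℝ) : Prop where
  memLp : MemLp P 2 unitMeasure
  a_pos : ∀ k, 0 < a k
  sum_a : ∑ k, a k = 1
  contracting : ∑ k, a k * d k ^ 2 < 1
  fixed : P =ᵐ[unitMeasure] similarityOp a d β P

/-- The self-similarity is arithmetic if the numbers `ln (a_k |d_k|)` with `d_k ≠ 0` are all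
integer multiples of one positive number. -/
def IsArithmetic {n : ℕ} (a d : Fin n → ℝ) : Prop :=
  ∃ ν : ℝ, 0 < ν ∧ ∀ k, d k ≠ 0 → ∃ m : ℤ, Real.log (a k * |d k|) = m * ν

/-- `D` is the positive spectral order: the positive solution of `∑ (a_k |d_k|)^{D/2} = 1`. -/
def IsPositiveSpectralOrder {n : ℕ} (a d : Fin n → ℝ) (D : ℝ) : Prop :=
  0 < D ∧ ∑ k, (a k * |d k|) ^ (D / 2) = 1

end SelfSimilarSL

end

/-!
Write `N(lam)` for the negative index of the form `∫ |y'|² + lam ∫ P (|y|²)'`.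

Self-similarity turns `N` into the solution of a renewal equation up to a bounded error. On the
functions that vanish at the ends of the intervals of the partition, a subspace of finite
codimension, the form splits into its restrictions to these intervals. Stretching the `k`-th
interval to `[0,1]` gives `a_k⁻¹` times the form with parameter `a_k d_k lam`; the shift `β_k`
contributes `β_k ∫ (|z|²)' = 0` (`pencil_eq_sum`). Hence
`∑ N(a_k d_k lam) ≤ N(lam) ≤ ∑ N(a_k d_k lam) + 2 n` (`sum_le_ind`, `ind_le_sum`). The upper
estimate rests on the fact that a hermitian form of negative index `m` is nonnegative on the
kernel of `m` functionals (`exists_nonneg_on_ker`). Since `N = 0` near `0`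
(`exists_ind_eq_zero`) and `a_k |d_k| < 1`, the index is finite everywhere (`ind_ne_top`).

In the logarithmic scale, `f_±(t) = exp(-D t / 2) N(± exp t)` solves a renewal system with
weights `(a_k |d_k|)^(D/2)`, steps `-ln(a_k |d_k|)` and an exponentially small defect; the steps
with `d_k < 0` exchange the two components. Bounds of the right order come from induction on the
scale (`exists_le_exp`, `exists_exp_le`); the second one gives the positivity of the limits.

Convergence is proved without Fourier analysis (`exists_tendsto_of_renewal`). Along times at which
`f` approaches its upper limit `V`, all translates by words in the steps approach `V` too, because
an average can reach `V` only if its members do. The words are asymptotically dense by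
non-arithmeticity, and `f` cannot drop fast since `N` is monotone in `|lam|`, so `f` is close to
`V` on long windows. The quantity `∑ p_k ∫_{t-τ_k}^t f` has the defect as its derivative, so it
converges to some `q`, and evaluating it on a window gives `V ∑ p_k τ_k ≤ q`. The same argument for
`-f` shows that the lower and upper limits agree. If some step exchanges the components, this
applies to `f_+ + f_-`, and two words of opposite signs at almost equal times show that neither
component can exceed half of the limit (`tendsto_of_tendsto_add`).
-/

namespace SelfSimilarSL

/-! ### The renewal theorem for finitely many non-arithmetic steps -/

/-- The additive semigroup generated by finitely many positive numbers that are not multiples of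
one number becomes arbitrarily dense at infinity. -/
theorem exists_closure_mem_Ioc {ι : Type*} (τ : ι → ℝ) (hτ : ∀ k, 0 < τ k)
    (hna : ¬ ∃ ν : ℝ, 0 < ν ∧ ∀ k, ∃ m : ℤ, τ k = m * ν) {ε : ℝ} (hε : 0 < ε) :
    ∃ T : ℝ, ∀ t, T ≤ t → ∃ s ∈ AddSubmonoid.closure (Set.range τ), t - ε < s ∧ s ≤ t := by
  set S := AddSubmonoid.closure (Set.range τ) with hS
  obtain ⟨k₀⟩ : Nonempty ι := by
    by_contra h
    rw [not_nonempty_iff] at h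
    exact hna ⟨1, one_pos, fun k => h.elim k⟩
  have hS0 : ∀ s ∈ S, 0 ≤ s := by
    intro s hs
    induction hs using AddSubmonoid.closure_induction with
    | mem x hx => obtain ⟨k, rfl⟩ := hx; exact (hτ k).le
    | zero => exact le_rfl
    | add x y _ _ hx hy => exact add_nonneg hx hy
  have hdense : Dense (AddSubgroup.closure (Set.range τ) : Set ℝ) := by
    rcases AddSubgroup.dense_or_cyclic (AddSubgroup.closure (Set.range τ)) with h | ⟨b, hb⟩
    · exact h
    · exfalso
      have hk : ∀ k, ∃ m : ℤ, τ k = m * b := by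
        intro k
        have : τ k ∈ AddSubgroup.closure (Set.range τ) :=
          AddSubgroup.subset_closure ⟨k, rfl⟩
        rw [hb, AddSubgroup.mem_closure_singleton] at this
        obtain ⟨m, hm⟩ := this
        exact ⟨m, by rw [← hm]; simp⟩
      have hb0 : b ≠ 0 := by
        rintro rfl
        obtain ⟨m, hm⟩ := hk k₀
        have := hτ k₀
        simp [hm] at this
      refine hna ⟨|b|, abs_pos.mpr hb0, fun k => ?_⟩
      obtain ⟨m, hm⟩ := hk k
      rcases abs_choice b with h | h
      · exact ⟨m, by rw [h, hm]⟩
      · exact ⟨-m, by rw [h, hm]; push_cast; ring⟩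
  obtain ⟨g, hgG, hg0, hgε⟩ := hdense.exists_between hε
  have hdiff : ∃ s₁ ∈ S, ∃ s₂ ∈ S, g = s₁ - s₂ := by
    clear hg0 hgε
    induction hgG using AddSubgroup.closure_induction with
    | mem x hx => exact ⟨x, AddSubmonoid.subset_closure hx, 0, S.zero_mem, by simp⟩
    | zero => exact ⟨0, S.zero_mem, 0, S.zero_mem, by simp⟩
    | add x y _ _ hx hy =>
      obtain ⟨x₁, hx₁, x₂, hx₂, rfl⟩ := hx
      obtain ⟨y₁, hy₁, y₂, hy₂, rfl⟩ := hy
      exact ⟨x₁ + y₁, S.add_mem hx₁ hy₁, x₂ + y₂, S.add_mem hx₂ hy₂, by ring⟩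
    | neg x _ hx =>
      obtain ⟨x₁, hx₁, x₂, hx₂, rfl⟩ := hx
      exact ⟨x₂, hx₂, x₁, hx₁, by ring⟩
  obtain ⟨s₁', hs₁', s₂', hs₂', hg'⟩ := hdiff
  have hk₀ : τ k₀ ∈ S := AddSubmonoid.subset_closure ⟨k₀, rfl⟩
  -- Adding a generator to both makes the subtrahend positive.
  obtain ⟨s₁, hs₁, s₂, hs₂, hs₂0, hg⟩ : ∃ s₁ ∈ S, ∃ s₂ ∈ S, 0 < s₂ ∧ g = s₁ - s₂ :=
    ⟨s₁' + τ k₀, S.add_mem hs₁' hk₀, s₂' + τ k₀, S.add_mem hs₂' hk₀,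
      add_pos_of_nonneg_of_pos (hS0 _ hs₂') (hτ k₀), by rw [hg']; ring⟩
  obtain ⟨m, hm⟩ := exists_nat_ge (s₂ / g)
  rw [div_le_iff₀ hg0] at hm
  -- Beyond `m s₂`, the elements `(q - j) s₂ + j s₁ = q s₂ + j g` have gaps at most `g < ε`.
  refine ⟨m * s₂, fun t ht => ?_⟩
  have ht0 : 0 ≤ t := le_trans (by positivity) ht
  set q := ⌊t / s₂⌋₊ with hq
  have hq1 : (q : ℝ) * s₂ ≤ t := by
    rw [← le_div_iff₀ hs₂0]; exact Nat.floor_le (by positivity)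
  have hq2 : t < (q + 1 : ℝ) * s₂ := by
    rw [← div_lt_iff₀ hs₂0]; exact Nat.lt_floor_add_one _
  have hmq : m ≤ q := Nat.le_floor (by rwa [le_div_iff₀ hs₂0])
  set j := ⌊(t - q * s₂) / g⌋₊ with hj
  have hj1 : (j : ℝ) * g ≤ t - q * s₂ := by
    rw [← le_div_iff₀ hg0]
    exact Nat.floor_le (div_nonneg (sub_nonneg.mpr hq1) hg0.le)
  have hj2 : t - q * s₂ < (j + 1 : ℝ) * g := by
    rw [← div_lt_iff₀ hg0]; exact Nat.lt_floor_add_one _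
  have hjm : j ≤ q := by
    refine le_trans ?_ hmq
    have : (j : ℝ) * g ≤ m * g := by linarith
    exact_mod_cast le_of_mul_le_mul_right this hg0
  refine ⟨(q - j) • s₂ + j • s₁, S.add_mem (S.nsmul_mem hs₂ _) (S.nsmul_mem hs₁ _), ?_⟩
  have : (q - j) • s₂ + j • s₁ = q * s₂ + j * g := by
    rw [nsmul_eq_mul, nsmul_eq_mul, Nat.cast_sub hjm, hg]; ring
  rw [this]
  constructor <;> linarith

/-- The upper limit at infinity of a bounded function is attained along a filter. -/
theorem exists_filter_tendsto_limsup {f : ℝ → ℝ} {C : ℝ} (hC : ∀ t, |f t| ≤ C) :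
    ∃ (V : ℝ) (l : Filter ℝ), l.NeBot ∧ l ≤ atTop ∧ Tendsto f l (𝓝 V) ∧
      ∀ η : ℝ, 0 < η → ∀ᶠ t in atTop, f t ≤ V + η := by
  have hb : IsBoundedUnder (· ≤ ·) atTop f :=
    isBoundedUnder_of ⟨C, fun t => (abs_le.mp (hC t)).2⟩
  have hb' : IsCoboundedUnder (· ≤ ·) atTop f :=
    (isBoundedUnder_of ⟨-C, fun t => (abs_le.mp (hC t)).1⟩ :
      IsBoundedUnder (· ≥ ·) atTop f).isCoboundedUnder_le
  have hup : ∀ η : ℝ, 0 < η → ∀ᶠ t in atTop, f t < limsup f atTop + η := fun η hη =>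
    eventually_lt_of_limsup_lt (lt_add_of_pos_right _ hη) hb
  have hcl : MapClusterPt (limsup f atTop) atTop f := by
    rw [Metric.nhds_basis_ball.mapClusterPt_iff_frequently]
    intro η hη
    have h1 : ∃ᶠ t in atTop, limsup f atTop - η < f t :=
      frequently_lt_of_lt_limsup hb' (sub_lt_self _ hη)
    refine (h1.and_eventually (hup η hη)).mono fun t ht => ?_
    rw [Metric.mem_ball, Real.dist_eq, abs_lt]
    constructor <;> linarith [ht.1, ht.2]
  obtain ⟨U, hU, hUf⟩ := mapClusterPt_iff_ultrafilter.mp hcl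
  exact ⟨limsup f atTop, U, inferInstance, hU, hUf, fun η hη => (hup η hη).mono fun t ht => ht.le⟩

section

variable {ι : Type*} [Fintype ι] {p τ : ι → ℝ}

theorem tendsto_sub_const_atTop (s : ℝ) : Tendsto (fun t : ℝ => t - s) atTop atTop :=
  tendsto_atTop_add_const_right _ (-s) tendsto_id

/-- If a solution of an approximate averaging system comes close to its upper limit `V` along `l`,
then so do all the functions that enter the average with positive weight. -/
theorem tendsto_shift_of_average (hp : ∀ k, 0 < p k) (hp1 : ∑ k, p k = 1)
    {f : Bool → ℝ → ℝ} {e : ι → Bool}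
    (h0 : ∀ σ, Tendsto (fun t => f σ t - ∑ k, p k * f (xor σ (e k)) (t - τ k)) atTop (𝓝 0))
    {V : ℝ} (hV : ∀ σ, ∀ η : ℝ, 0 < η → ∀ᶠ t in atTop, f σ t ≤ V + η)
    {l : Filter ℝ} (hl : l ≤ atTop) {σ : Bool} (hf : Tendsto (f σ) l (𝓝 V)) (k : ι) :
    Tendsto (fun t => f (xor σ (e k)) (t - τ k)) l (𝓝 V) := by
  classical
  rw [tendsto_order]
  have hup : ∀ j : ι, ∀ η : ℝ, 0 < η →
      ∀ᶠ t in l, f (xor σ (e j)) (t - τ j) ≤ V + η := fun j η hη =>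
    hl ((tendsto_sub_const_atTop (τ j)).eventually (hV (xor σ (e j)) η hη))
  constructor
  · intro v hv
    set η := p k * (V - v) / 4 with hη
    have hη0 : 0 < η := by have := hp k; have := sub_pos.mpr hv; positivity
    have h1 := hf.eventually (lt_mem_nhds (sub_lt_self V hη0))
    have h2 := ((h0 σ).mono_left hl).eventually (gt_mem_nhds hη0)
    have h3 : ∀ᶠ t in l, ∀ j, f (xor σ (e j)) (t - τ j) ≤ V + η :=
      eventually_all.mpr fun j => hup j η hη0
    filter_upwards [h1, h2, h3] with t ht1 ht2 ht3
    rw [← Finset.add_sum_erase _ _ (Finset.mem_univ k)] at ht2 hp1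
    have h4 : ∑ j ∈ Finset.univ.erase k, p j * f (xor σ (e j)) (t - τ j) ≤
        ∑ j ∈ Finset.univ.erase k, p j * (V + η) :=
      Finset.sum_le_sum fun j _ => mul_le_mul_of_nonneg_left (ht3 j) (hp j).le
    rw [← Finset.sum_mul] at h4
    have h5 : ∑ j ∈ Finset.univ.erase k, p j = 1 - p k := by linarith
    rw [h5] at h4
    have h6 : 0 < p k * (f (xor σ (e k)) (t - τ k) - v) := by
      have : 0 < p k * η := mul_pos (hp k) hη0
      nlinarith
    have := (mul_pos_iff_of_pos_left (hp k)).mp h6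
    linarith
  · intro v hv
    filter_upwards [hup k ((v - V) / 2) (by linarith)] with t ht
    linarith

/-- Iterating `tendsto_shift_of_average`: words in which each step occurs an even number of times
do not change the index `σ`. -/
theorem tendsto_shift_of_mem_closure (hp : ∀ k, 0 < p k) (hp1 : ∑ k, p k = 1)
    {f : Bool → ℝ → ℝ} {e : ι → Bool}
    (h0 : ∀ σ, Tendsto (fun t => f σ t - ∑ k, p k * f (xor σ (e k)) (t - τ k)) atTop (𝓝 0))
    {V : ℝ} (hV : ∀ σ, ∀ η : ℝ, 0 < η → ∀ᶠ t in atTop, f σ t ≤ V + η)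
    {l : Filter ℝ} (hl : l ≤ atTop) {σ : Bool} (hf : Tendsto (f σ) l (𝓝 V)) {s : ℝ}
    (hs : s ∈ AddSubmonoid.closure (Set.range fun k => 2 * τ k)) :
    Tendsto (fun t => f σ (t - s)) l (𝓝 V) := by
  have hshift : ∀ {m : Filter ℝ} (r : ℝ), m ≤ atTop → map (fun t => t - r) m ≤ atTop :=
    fun r hm => (tendsto_sub_const_atTop r).mono_left hm
  induction hs using AddSubmonoid.closure_induction generalizing l with
  | mem x hx =>
    obtain ⟨k, rfl⟩ := hx
    have h1 := tendsto_shift_of_average hp hp1 h0 hV hl hf k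
    have h2 := tendsto_shift_of_average hp hp1 h0 hV (hshift (τ k) hl)
      (σ := xor σ (e k)) (tendsto_map'_iff.mpr h1) k
    rw [tendsto_map'_iff] at h2
    refine h2.congr fun t => ?_
    simp only [Function.comp_apply, Bool.xor_assoc, Bool.xor_self, Bool.xor_false]
    congr 1
    ring
  | zero => simpa using hf
  | add x y _ _ hx hy =>
    have h1 := hy (l := map (fun t => t - x) l) (hshift x hl) (tendsto_map'_iff.mpr (hx hl hf))
    rw [tendsto_map'_iff] at h1
    refine h1.congr fun t => ?_
    simp only [Function.comp_apply]
    congr 1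
    ring

theorem not_arithmetic_two_mul {ι : Type*} {τ : ι → ℝ}
    (hna : ¬ ∃ ν : ℝ, 0 < ν ∧ ∀ k, ∃ m : ℤ, τ k = m * ν) :
    ¬ ∃ ν : ℝ, 0 < ν ∧ ∀ k, ∃ m : ℤ, 2 * τ k = m * ν := by
  rintro ⟨ν, hν, h⟩
  refine hna ⟨ν / 2, by positivity, fun k => ?_⟩
  obtain ⟨m, hm⟩ := h k
  exact ⟨m, by linarith⟩

/-- Near its upper limit `V`, an averaging function with one-sided Lipschitz regularity is close to
`V` on whole windows of a prescribed length: the translates by the dense set of words reach every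
point of the window up to a small error, which the regularity absorbs. -/
theorem exists_window (hp : ∀ k, 0 < p k) (hp1 : ∑ k, p k = 1) (hτ : ∀ k, 0 < τ k)
    (hna : ¬ ∃ ν : ℝ, 0 < ν ∧ ∀ k, ∃ m : ℤ, τ k = m * ν) {f : ℝ → ℝ} {K : ℝ} (hK : 0 ≤ K)
    (hslow : (∀ t δ, 0 ≤ δ → f t - K * δ ≤ f (t + δ)) ∨
      (∀ t δ, 0 ≤ δ → f (t + δ) - K * δ ≤ f t))
    (h0 : Tendsto (fun t => f t - ∑ k, p k * f (t - τ k)) atTop (𝓝 0))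
    {V : ℝ} (hV : ∀ η : ℝ, 0 < η → ∀ᶠ t in atTop, f t ≤ V + η)
    {l : Filter ℝ} (hl : l ≤ atTop) (hf : Tendsto f l (𝓝 V)) (L : ℝ) {η : ℝ} (hη : 0 < η) :
    ∃ T : ℝ, ∀ᶠ t in l, ∀ u, t - T - L ≤ u → u ≤ t - T → V - η ≤ f u := by
  obtain ⟨ε, hε, hKε⟩ : ∃ ε : ℝ, 0 < ε ∧ K * (2 * ε) ≤ η / 2 := by
    refine ⟨η / (4 * (K + 1)), by positivity, ?_⟩
    rw [show K * (2 * (η / (4 * (K + 1)))) = (η / 2) * (K / (K + 1)) by field_simp; ring]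
    have : K / (K + 1) ≤ 1 := by rw [div_le_one (by positivity)]; linarith
    nlinarith
  obtain ⟨T, hT⟩ := exists_closure_mem_Ioc (fun k => 2 * τ k)
    (fun k => by have := hτ k; positivity) (not_arithmetic_two_mul hna) hε
  obtain ⟨N, hN⟩ := exists_nat_ge (L / ε)
  rw [div_le_iff₀ hε] at hN
  have hgrid : ∀ i : Fin (N + 4), ∃ s ∈ AddSubmonoid.closure (Set.range fun k => 2 * τ k),
      T + i * ε - ε < s ∧ s ≤ T + i * ε := fun i => hT _ (by
    have : (0 : ℝ) ≤ (i : ℕ) * ε := by positivity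
    linarith)
  choose s hsS hs1 hs2 using hgrid
  have hev : ∀ᶠ t in l, ∀ i, V - η / 2 < f (t - s i) := eventually_all.mpr fun i =>
    (tendsto_shift_of_mem_closure (f := fun _ => f) (e := fun _ => false) hp hp1 (fun _ => h0)
      (fun _ => hV) hl (σ := false) hf (hsS i)).eventually (lt_mem_nhds (by linarith))
  refine ⟨T + ε, hev.mono fun t ht u hu1 hu2 => ?_⟩
  -- The point `t - u` lies between two consecutive points of the grid `T + i ε`.
  set j := ⌊(t - u - T) / ε⌋₊ with hj
  have hr : 0 ≤ t - u - T := by linarith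
  have hj1 : (j : ℝ) * ε ≤ t - u - T := by
    rw [← le_div_iff₀ hε]; exact Nat.floor_le (by positivity)
  have hj2 : t - u - T < (j + 1 : ℝ) * ε := by
    rw [← div_lt_iff₀ hε]; exact Nat.lt_floor_add_one _
  have hjN : j < N + 1 + 1 := by
    have : (j : ℝ) * ε < (N + 1 + 1 : ℕ) * ε := by push_cast; nlinarith
    exact_mod_cast lt_of_mul_lt_mul_right this hε.le
  rcases hslow with hslow | hslow
  · have h1 := hs1 ⟨j + 2, by omega⟩
    have h2 := hs2 ⟨j + 2, by omega⟩
    have h3 := ht ⟨j + 2, by omega⟩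
    set r := s ⟨j + 2, by omega⟩
    push_cast at h1 h2
    have h4 := hslow (t - r) (u - (t - r)) (by linarith)
    rw [add_sub_cancel] at h4
    have : K * (u - (t - r)) ≤ K * (2 * ε) := mul_le_mul_of_nonneg_left (by linarith) hK
    linarith
  · have h1 := hs1 ⟨j, by omega⟩
    have h2 := hs2 ⟨j, by omega⟩
    have h3 := ht ⟨j, by omega⟩
    set r := s ⟨j, by omega⟩
    push_cast at h1 h2
    have h4 := hslow u (t - r - u) (by linarith)
    rw [add_sub_cancel] at h4
    have : K * (t - r - u) ≤ K * (2 * ε) := mul_le_mul_of_nonneg_left (by linarith) hK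
    linarith

theorem intervalIntegrable_of_bounded {f : ℝ → ℝ} (hfm : Measurable f) {C : ℝ}
    (hC : ∀ t, |f t| ≤ C) (a b : ℝ) : IntervalIntegrable f volume a b :=
  (intervalIntegrable_const (c := C)).mono_fun hfm.aestronglyMeasurable
    (Eventually.of_forall fun t => by
      simpa [Real.norm_eq_abs] using (hC t).trans (le_abs_self C))

/-- The quantity `∑ p_k ∫_{t-τ_k}^t f` has the derivative `f - ∑ p_k f(· - τ_k)`; hence it
converges at infinity if this defect is integrable. -/
theorem exists_tendsto_sum_integral (hp1 : ∑ k, p k = 1) {f : ℝ → ℝ}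
    (hfm : Measurable f) {C : ℝ} (hC : ∀ t, |f t| ≤ C)
    (hint : IntegrableOn (fun t => f t - ∑ k, p k * f (t - τ k)) (Set.Ioi 0)) :
    ∃ q : ℝ, Tendsto (fun t => ∑ k, p k * ∫ u in (t - τ k)..t, f u) atTop (𝓝 q) := by
  have hii := intervalIntegrable_of_bounded hfm hC
  have hii' : ∀ (k : ι) (a b : ℝ), IntervalIntegrable (fun u => f (u - τ k)) volume a b :=
    fun k a b => intervalIntegrable_of_bounded (hfm.comp (measurable_id.sub_const _))
      (fun t => hC _) a b
  have hlim := (intervalIntegral_tendsto_integral_Ioi 0 hint tendsto_id).const_add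
    (∑ k, p k * ∫ u in (0 - τ k)..0, f u)
  refine ⟨_, hlim.congr fun t => ?_⟩
  simp only [id]
  have hsum : IntervalIntegrable (fun u => ∑ k, p k * f (u - τ k)) volume 0 t := by
    simpa only [Finset.sum_fn] using
      IntervalIntegrable.sum Finset.univ fun k _ => (hii' k 0 t).const_mul (p k)
  rw [intervalIntegral.integral_sub (hii _ _) hsum,
    intervalIntegral.integral_finsetSum fun k _ => (hii' k _ _).const_mul _]
  simp only [intervalIntegral.integral_const_mul, intervalIntegral.integral_comp_sub_right]
  have h1 : ∫ u in (0 : ℝ)..t, f u = ∑ k, p k * ∫ u in (0 : ℝ)..t, f u := by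
    rw [← Finset.sum_mul, hp1, one_mul]
  rw [h1, ← Finset.sum_sub_distrib, ← Finset.sum_add_distrib]
  refine Finset.sum_congr rfl fun k _ => ?_
  have h2 := intervalIntegral.integral_add_adjacent_intervals (hii (0 - τ k) 0) (hii 0 t)
  have h3 := intervalIntegral.integral_add_adjacent_intervals (hii (0 - τ k) (t - τ k))
    (hii (t - τ k) t)
  rw [← mul_sub, ← mul_add]
  congr 1
  linarith

/-- The upper limit of the solution is at most `q / ∑ p_k τ_k`, where `q` is the limit of
`∑ p_k ∫_{t-τ_k}^t f`. -/
theorem exists_eventually_le (hp : ∀ k, 0 < p k) (hp1 : ∑ k, p k = 1) (hτ : ∀ k, 0 < τ k)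
    (hna : ¬ ∃ ν : ℝ, 0 < ν ∧ ∀ k, ∃ m : ℤ, τ k = m * ν) {f : ℝ → ℝ} {K : ℝ} (hK : 0 ≤ K)
    (hslow : (∀ t δ, 0 ≤ δ → f t - K * δ ≤ f (t + δ)) ∨
      (∀ t δ, 0 ≤ δ → f (t + δ) - K * δ ≤ f t))
    (hfm : Measurable f) {C : ℝ} (hC : ∀ t, |f t| ≤ C)
    (h0 : Tendsto (fun t => f t - ∑ k, p k * f (t - τ k)) atTop (𝓝 0))
    {q : ℝ} (hq : Tendsto (fun t => ∑ k, p k * ∫ u in (t - τ k)..t, f u) atTop (𝓝 q)) :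
    ∃ V : ℝ, (∑ k, p k * τ k) * V ≤ q ∧ ∀ η : ℝ, 0 < η → ∀ᶠ t in atTop, f t ≤ V + η := by
  obtain ⟨V, l, hne, hl, hf, hV⟩ := exists_filter_tendsto_limsup hC
  refine ⟨V, ?_, hV⟩
  have key : ∀ η : ℝ, 0 < η → (∑ k, p k * τ k) * (V - η) ≤ q := by
    intro η hη
    obtain ⟨T, hT⟩ := exists_window hp hp1 hτ hna hK hslow h0 hV hl hf (∑ k, τ k) hη
    refine ge_of_tendsto ((hq.comp (tendsto_sub_const_atTop T)).mono_left hl) ?_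
    filter_upwards [hT] with t ht
    simp only [Function.comp_apply]
    rw [Finset.sum_mul]
    refine Finset.sum_le_sum fun k _ => ?_
    rw [mul_assoc]
    refine mul_le_mul_of_nonneg_left ?_ (hp k).le
    have hk : τ k ≤ ∑ j, τ j :=
      Finset.single_le_sum (f := τ) (fun j _ => (hτ j).le) (Finset.mem_univ k)
    have h1 : ∫ _ in (t - T - τ k)..(t - T), (V - η) ≤ ∫ u in (t - T - τ k)..(t - T), f u := by
      refine intervalIntegral.integral_mono_on (by linarith [hτ k]) (by simp)
        (intervalIntegrable_of_bounded hfm hC _ _) fun u hu => ht u ?_ hu.2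
      linarith [hu.1]
    rwa [intervalIntegral.integral_const, sub_sub_cancel, smul_eq_mul] at h1
  have hlim : Tendsto (fun η : ℝ => (∑ k, p k * τ k) * (V - η)) (𝓝[>] 0)
      (𝓝 ((∑ k, p k * τ k) * (V - 0))) :=
    ((tendsto_const_nhds.sub tendsto_id).const_mul _).mono_left nhdsWithin_le_nhds
  rw [sub_zero] at hlim
  exact le_of_tendsto hlim (eventually_mem_nhdsWithin.mono fun η hη => key η hη)

/-- Renewal theorem: a bounded solution of a non-arithmetic renewal equation with integrable
right-hand side, decreasing at most at a bounded rate, converges at infinity. -/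
theorem exists_tendsto_of_renewal (hp : ∀ k, 0 < p k) (hp1 : ∑ k, p k = 1) (hτ : ∀ k, 0 < τ k)
    (hna : ¬ ∃ ν : ℝ, 0 < ν ∧ ∀ k, ∃ m : ℤ, τ k = m * ν) {f : ℝ → ℝ} {K : ℝ} (hK : 0 ≤ K)
    (hslow : ∀ t δ, 0 ≤ δ → f t - K * δ ≤ f (t + δ))
    (hfm : Measurable f) {C : ℝ} (hC : ∀ t, |f t| ≤ C)
    (h0 : Tendsto (fun t => f t - ∑ k, p k * f (t - τ k)) atTop (𝓝 0))
    (hint : IntegrableOn (fun t => f t - ∑ k, p k * f (t - τ k)) (Set.Ioi 0)) :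
    ∃ s : ℝ, Tendsto f atTop (𝓝 s) := by
  obtain ⟨q, hq⟩ := exists_tendsto_sum_integral hp1 hfm hC hint
  obtain ⟨V, hVq, hV⟩ := exists_eventually_le hp hp1 hτ hna hK (Or.inl hslow) hfm hC h0 hq
  have h0' : Tendsto (fun t => -f t - ∑ k, p k * -f (t - τ k)) atTop (𝓝 0) := by
    have := h0.neg
    rw [neg_zero] at this
    refine this.congr fun t => ?_
    simp only [mul_neg, Finset.sum_neg_distrib]
    ring
  have hq' : Tendsto (fun t => ∑ k, p k * ∫ u in (t - τ k)..t, -f u) atTop (𝓝 (-q)) := by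
    refine hq.neg.congr fun t => ?_
    simp only [intervalIntegral.integral_neg, mul_neg, Finset.sum_neg_distrib]
  obtain ⟨W, hWq, hW⟩ := exists_eventually_le (f := fun t => -f t) hp hp1 hτ hna hK
    (Or.inr fun t δ hδ => by linarith [hslow t δ hδ]) hfm.neg (fun t => by rw [abs_neg]; exact hC t)
    h0' hq'
  have hm : 0 < ∑ k, p k * τ k := by
    refine Finset.sum_pos (fun k _ => mul_pos (hp k) (hτ k)) ?_
    rw [Finset.univ_nonempty_iff]
    by_contra h
    rw [not_nonempty_iff] at h
    simp at hp1
  -- `V ≤ q / m` and `W ≤ -q / m` for `m = ∑ p_k τ_k` leave no room between the lower and the upper limit.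
  have hVW : V + W ≤ 0 := by
    by_contra! h
    have := mul_pos hm h
    linarith
  refine ⟨V, Metric.tendsto_nhds.mpr fun η hη => ?_⟩
  filter_upwards [hV (η / 2) (by positivity), hW (η / 2) (by positivity)] with t h1 h2
  rw [Real.dist_eq, abs_lt]
  constructor <;> linarith

/-- If the steps of a non-arithmetic two-component renewal system sometimes exchange the components,
both components have the same limit. -/
theorem tendsto_of_tendsto_add (hp : ∀ k, 0 < p k) (hp1 : ∑ k, p k = 1) (hτ : ∀ k, 0 < τ k)
    (hna : ¬ ∃ ν : ℝ, 0 < ν ∧ ∀ k, ∃ m : ℤ, τ k = m * ν) {f : Bool → ℝ → ℝ} {e : ι → Bool}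
    {K : ℝ} (hK : 0 ≤ K) (hslow : ∀ σ t δ, 0 ≤ δ → f σ t - K * δ ≤ f σ (t + δ))
    {C : ℝ} (hC : ∀ σ t, |f σ t| ≤ C)
    (h0 : ∀ σ, Tendsto (fun t => f σ t - ∑ k, p k * f (xor σ (e k)) (t - τ k)) atTop (𝓝 0))
    {k₀ : ι} (hk₀ : e k₀ = true) {s : ℝ}
    (hs : Tendsto (fun t => f false t + f true t) atTop (𝓝 (2 * s))) (σ : Bool) :
    Tendsto (f σ) atTop (𝓝 s) := by
  obtain ⟨V, σ₀, l, hne, hl, hf, hV⟩ : ∃ (V : ℝ) (σ₀ : Bool) (l : Filter ℝ), l.NeBot ∧ l ≤ atTop ∧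
      Tendsto (f σ₀) l (𝓝 V) ∧ ∀ σ, ∀ η : ℝ, 0 < η → ∀ᶠ t in atTop, f σ t ≤ V + η := by
    obtain ⟨V₁, l₁, hne₁, hl₁, hf₁, hV₁⟩ := exists_filter_tendsto_limsup (hC false)
    obtain ⟨V₂, l₂, hne₂, hl₂, hf₂, hV₂⟩ := exists_filter_tendsto_limsup (hC true)
    rcases le_total V₁ V₂ with h | h
    · refine ⟨V₂, true, l₂, hne₂, hl₂, hf₂, fun σ η hη => ?_⟩
      cases σ
      · exact (hV₁ η hη).mono fun t ht => by linarith
      · exact hV₂ η hη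
    · refine ⟨V₁, false, l₁, hne₁, hl₁, hf₁, fun σ η hη => ?_⟩
      cases σ
      · exact hV₁ η hη
      · exact (hV₂ η hη).mono fun t ht => by linarith
  have hs' : Tendsto (fun t => f σ₀ t + f (!σ₀) t) atTop (𝓝 (2 * s)) := by
    cases σ₀
    · exact hs
    · exact hs.congr fun t => add_comm _ _
  have hVs : V ≤ s := by
    have key : ∀ ε : ℝ, 0 < ε → V + V - K * ε ≤ 2 * s := by
      intro ε hε
      obtain ⟨T, hT⟩ := exists_closure_mem_Ioc (fun k => 2 * τ k)
        (fun k => by have := hτ k; positivity) (not_arithmetic_two_mul hna) hε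
      obtain ⟨s₂, hs₂, hs₂T, -⟩ := hT (T + ε) (by linarith)
      -- Two words of opposite signs at times `s₁ ≤ τ k₀ + s₂`, less than `ε` apart.
      obtain ⟨s₁, hs₁, hs₁', hs₁''⟩ := hT (τ k₀ + s₂) (by linarith [hτ k₀])
      have h1 := tendsto_shift_of_mem_closure hp hp1 h0 hV hl hf hs₁
      have h2 := tendsto_shift_of_average hp hp1 h0 hV hl hf k₀
      rw [hk₀, Bool.xor_true] at h2
      have h3 := tendsto_shift_of_mem_closure hp hp1 h0 hV
        ((tendsto_sub_const_atTop (τ k₀)).mono_left hl) (tendsto_map'_iff.mpr h2) hs₂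
      rw [tendsto_map'_iff] at h3
      refine le_of_tendsto_of_tendsto ((h1.add h3).sub_const (K * ε))
        ((hs'.comp (tendsto_sub_const_atTop s₁)).mono_left hl) (Eventually.of_forall fun t => ?_)
      simp only [Function.comp_apply]
      have h4 := hslow (!σ₀) (t - τ k₀ - s₂) (τ k₀ + s₂ - s₁) (by linarith)
      rw [show t - τ k₀ - s₂ + (τ k₀ + s₂ - s₁) = t - s₁ by ring] at h4
      have h5 : K * (τ k₀ + s₂ - s₁) ≤ K * ε := mul_le_mul_of_nonneg_left (by linarith) hK
      linarith
    have hlim : Tendsto (fun ε : ℝ => V + V - K * ε) (𝓝[>] 0) (𝓝 (V + V - K * 0)) :=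
      (tendsto_const_nhds.sub (tendsto_id.const_mul K)).mono_left nhdsWithin_le_nhds
    have := le_of_tendsto hlim (eventually_mem_nhdsWithin.mono fun ε hε => key ε hε)
    linarith
  refine Metric.tendsto_nhds.mpr fun η hη => ?_
  filter_upwards [hV false (η / 4) (by positivity), hV true (η / 4) (by positivity),
    hs.eventually (lt_mem_nhds (show 2 * s - η / 4 < 2 * s by linarith))] with t h1 h2 h3
  rw [Real.dist_eq, abs_lt]
  cases σ <;> constructor <;> linarith

end

/-! ### The negative index of inertia -/

section NegIndex

variable {E : Type*} [AddCommGroup E] [Module ℂ E]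

theorem finrank_le_negIndex {F : E → E → ℂ} {W : Type*} [AddCommGroup W] [Module ℂ W]
    [FiniteDimensional ℂ W] (hF0 : (F 0 0).re = 0) (J : W →ₗ[ℂ] E)
    (hJ : ∀ w, w ≠ 0 → (F (J w) (J w)).re < 0) :
    (Module.finrank ℂ W : ℕ∞) ≤ negIndex F := by
  have hinj : Function.Injective J := by
    rw [injective_iff_map_eq_zero]
    intro w hw
    by_contra h
    have := hJ w h
    rw [hw, hF0] at this
    exact lt_irrefl _ this
  rw [← LinearMap.finrank_range_of_inj hinj]
  refine le_iSup₂_of_le (LinearMap.range J) ⟨inferInstance, ?_⟩ le_rfl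
  rintro _ ⟨w, rfl⟩ hw
  exact hJ w fun h => hw (by rw [h, map_zero])

/-- If a form is nonnegative on the kernel of a linear map, then every negative definite subspace
is mapped injectively. -/
theorem negIndex_le_finrank {F : E → E → ℂ} {W : Type*} [AddCommGroup W] [Module ℂ W]
    [FiniteDimensional ℂ W] (Φ : E →ₗ[ℂ] W) (hΦ : ∀ y, Φ y = 0 → 0 ≤ (F y y).re) :
    negIndex F ≤ Module.finrank ℂ W := by
  refine iSup₂_le fun M hM => ?_
  obtain ⟨hfd, hM⟩ := hM
  have hinj : Function.Injective (Φ ∘ₗ M.subtype) := by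
    rw [injective_iff_map_eq_zero]
    rintro ⟨y, hy⟩ h
    by_contra hne
    have hy0 : y ≠ 0 := fun h0 => hne (by simpa using h0)
    exact absurd (hM y hy hy0) (not_lt.mpr (hΦ y h))
  exact_mod_cast LinearMap.finrank_le_finrank_of_injective hinj

theorem exists_submodule_finrank_eq {F : E → E → ℂ} (hF : negIndex F ≠ ⊤) :
    ∃ M : Submodule ℂ E, FiniteDimensional ℂ M ∧ (∀ y ∈ M, y ≠ 0 → (F y y).re < 0) ∧
      Module.finrank ℂ M = (negIndex F).toNat := by
  have h : negIndex F = ⨆ M : {M : Submodule ℂ E // FiniteDimensional ℂ M ∧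
      ∀ y ∈ M, y ≠ 0 → (F y y).re < 0}, (Module.finrank ℂ M.1 : ℕ∞) := by
    rw [negIndex, iSup_subtype]
  have : Nonempty {M : Submodule ℂ E // FiniteDimensional ℂ M ∧
      ∀ y ∈ M, y ≠ 0 → (F y y).re < 0} :=
    ⟨⊥, inferInstance, fun y hy h0 => absurd ((Submodule.mem_bot ℂ).mp hy) h0⟩
  obtain ⟨⟨M, hfd, hM⟩, hMe⟩ := ENat.exists_eq_iSup_of_lt_top (h ▸ hF.lt_top)
  refine ⟨M, hfd, hM, ?_⟩
  rw [h, ← hMe]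
  simp

/-- A hermitian form with finite negative index `m` is nonnegative on the kernel of `m` linear
functionals, namely on the orthogonal complement of a maximal negative definite subspace. -/
theorem exists_nonneg_on_ker (B : E →ₗ[ℂ] E →ₗ⋆[ℂ] ℂ)
    (hB : ∀ x y, B y x = starRingEnd ℂ (B x y)) (hfin : negIndex (fun x y => B x y) ≠ ⊤) :
    ∃ Φ : E →ₗ[ℂ] (Fin (negIndex fun x y => B x y).toNat → ℂ),
      ∀ y, Φ y = 0 → 0 ≤ (B y y).re := by
  obtain ⟨M, hfd, hM, hrank⟩ := exists_submodule_finrank_eq hfin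
  set m := (negIndex fun x y => B x y).toNat with hm
  let b := Module.finBasisOfFinrankEq ℂ M hrank
  refine ⟨LinearMap.pi fun i => B.flip (b i : E), fun y hy => ?_⟩
  have horth : ∀ w ∈ M, B y w = 0 := by
    have : (B y).comp M.subtype = 0 := b.ext fun i => by
      simpa using congrFun hy i
    intro w hw
    exact LinearMap.congr_fun this ⟨w, hw⟩
  by_contra! hneg
  have hle := finrank_le_negIndex (F := fun x y => B x y) (by simp)
    (M.subtype.coprod (LinearMap.toSpanSingleton ℂ E y)) (by
      rintro ⟨⟨w, hw⟩, c⟩ hne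
      have h1 : B y w = 0 := horth w hw
      have h2 : B w y = 0 := by rw [hB, h1, map_zero]
      have h3 : (B (w + c • y) (w + c • y)).re = (B w w).re + ‖c‖ ^ 2 * (B y y).re := by
        simp only [map_add, LinearMap.add_apply, map_smul, LinearMap.smul_apply,
          LinearMap.map_smulₛₗ, h1, h2, smul_eq_mul, mul_zero, add_zero, zero_add]
        rw [Complex.add_re, ← mul_assoc, mul_comm (starRingEnd ℂ c) c, Complex.mul_conj',
          ← Complex.ofReal_pow, Complex.re_ofReal_mul]
      simp only [LinearMap.coprod_apply, Submodule.subtype_apply,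
        LinearMap.toSpanSingleton_apply]
      rw [h3]
      by_cases hc : c = 0
      · have hw0 : w ≠ 0 := by
          rintro rfl
          exact hne (by simp [hc])
        simpa [hc] using hM w hw hw0
      · have hc' : 0 < ‖c‖ ^ 2 := by positivity
        have hw' : (B w w).re ≤ 0 := by
          by_cases hw0 : w = 0
          · simp [hw0]
          · exact (hM w hw hw0).le
        nlinarith [mul_neg_of_pos_of_neg hc' hneg])
  rw [Module.finrank_prod, hrank, Module.finrank_self, ← ENat.natCast_toNat hfin] at hle
  have : m + 1 ≤ m := by exact_mod_cast hle
  omega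

variable {κ : Type*} [Fintype κ]

/-- If, on the kernel of a linear map into `W`, a form is the sum of pullbacks of hermitian forms,
then its negative index is at most the sum of their negative indices plus the dimension
of `W`. -/
theorem negIndex_le_sum_add {F : E → E → ℂ} {W : Type*} [AddCommGroup W] [Module ℂ W]
    [FiniteDimensional ℂ W] (Ψ : E →ₗ[ℂ] W) (B : κ → E →ₗ[ℂ] E →ₗ⋆[ℂ] ℂ)
    (hB : ∀ k x y, B k y x = starRingEnd ℂ (B k x y))
    (hfin : ∀ k, negIndex (fun x y => B k x y) ≠ ⊤) (L : κ → LinearMap.ker Ψ →ₗ[ℂ] E)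
    {c : κ → ℝ} (hc : ∀ k, 0 ≤ c k)
    (hF : ∀ y : LinearMap.ker Ψ, (F y y).re = ∑ k, c k * (B k (L k y) (L k y)).re) :
    negIndex F ≤
      ((∑ k, (negIndex fun x y => B k x y).toNat + Module.finrank ℂ W : ℕ) : ℕ∞) := by
  choose Φ hΦ using fun k => exists_nonneg_on_ker (B k) (hB k) (hfin k)
  choose G hG using fun k => (Φ k ∘ₗ L k).exists_extend
  refine (negIndex_le_finrank ((LinearMap.pi G).prod Ψ) fun y hy => ?_).trans (le_of_eq ?_)
  · obtain ⟨hy1, hy2⟩ := Prod.mk_eq_zero.mp hy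
    have := hF ⟨y, hy2⟩
    rw [this]
    refine Finset.sum_nonneg fun k _ => mul_nonneg (hc k) (hΦ k _ ?_)
    have h1 := LinearMap.congr_fun (hG k) ⟨y, hy2⟩
    rw [← LinearMap.comp_apply, ← h1]
    exact congrFun hy1 k
  · rw [Module.finrank_prod, Module.finrank_pi_fintype]
    simp

/-- If a form restricts to a weighted sum of forms on a product, then its negative index is at
least the sum of their negative indices. -/
theorem sum_le_negIndex {F : E → E → ℂ} (hF0 : (F 0 0).re = 0) (G : κ → E → E → ℂ)
    (hG0 : ∀ k, (G k 0 0).re = 0)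
    (hfin : ∀ k, negIndex (G k) ≠ ⊤) (J : (κ → E) →ₗ[ℂ] E) {c : κ → ℝ} (hc : ∀ k, 0 < c k)
    (hF : ∀ z, (F (J z) (J z)).re = ∑ k, c k * (G k (z k) (z k)).re) :
    ((∑ k, (negIndex (G k)).toNat : ℕ) : ℕ∞) ≤ negIndex F := by
  choose M hfd hM hrank using fun k => exists_submodule_finrank_eq (hfin k)
  have hle := finrank_le_negIndex hF0
    (J ∘ₗ LinearMap.pi fun k => (M k).subtype ∘ₗ LinearMap.proj (φ := fun k => M k) k) (by
      intro w hw
      rw [LinearMap.comp_apply, hF]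
      obtain ⟨k₀, hk₀⟩ := Function.ne_iff.mp hw
      refine Finset.sum_neg' (fun k _ => ?_) ⟨k₀, Finset.mem_univ _, ?_⟩
      · by_cases h : (w k : E) = 0
        · simp [h, hG0]
        · exact (mul_neg_of_pos_of_neg (hc k) (hM k _ (w k).2 h)).le
      · exact mul_neg_of_pos_of_neg (hc k₀) (hM k₀ _ (w k₀).2 fun h => hk₀ (by simpa using h)))
  rw [Module.finrank_pi_fintype] at hle
  simpa only [hrank] using hle

end NegIndex

/-! ### Absolutely continuous functions -/

theorem _root_.AbsolutelyContinuousOnInterval.comp_monotone {X : Type*} [PseudoMetricSpace X]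
    {f : ℝ → X} {a b c d : ℝ} (hf : AbsolutelyContinuousOnInterval f c d) {φ : ℝ → ℝ}
    (hφ : Monotone φ) {K : NNReal} (hK : LipschitzWith K φ)
    (hmaps : ∀ x ∈ Set.uIcc a b, φ x ∈ Set.uIcc c d) :
    AbsolutelyContinuousOnInterval (fun x => f (φ x)) a b := by
  rw [absolutelyContinuousOnInterval_iff] at hf ⊢
  intro ε hε
  obtain ⟨δ, hδ, h⟩ := hf ε hε
  refine ⟨δ / (K + 1), by positivity, ?_⟩
  rintro ⟨n, I⟩ ⟨hI1, hI2⟩ hsum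
  refine h (n, fun i => (φ (I i).1, φ (I i).2)) ⟨fun i hi => ?_, fun i hi j hj hij => ?_⟩ ?_
  · exact ⟨hmaps _ (hI1 i hi).1, hmaps _ (hI1 i hi).2⟩
  · have := hI2 hi hj hij
    simp only [Function.onFun, Set.uIoc, Set.Ioc_disjoint_Ioc] at this ⊢
    simp only [← hφ.map_max, ← hφ.map_min]
    exact hφ this
  · calc ∑ i ∈ Finset.range n, dist (φ (I i).1) (φ (I i).2)
        ≤ ∑ i ∈ Finset.range n, (K + 1) * dist (I i).1 (I i).2 :=
          Finset.sum_le_sum fun i _ => (hK.dist_le_mul _ _).trans (by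
            have := dist_nonneg (x := (I i).1) (y := (I i).2)
            linarith)
      _ = (K + 1) * ∑ i ∈ Finset.range n, dist (I i).1 (I i).2 := by rw [Finset.mul_sum]
      _ < (K + 1) * (δ / (K + 1)) := by
          have : (0 : ℝ) < K + 1 := by positivity
          exact mul_lt_mul_of_pos_left hsum this
      _ = δ := by field_simp

theorem _root_.AbsolutelyContinuousOnInterval.congr {X : Type*} [PseudoMetricSpace X]
    {f g : ℝ → X} {a b : ℝ} (hf : AbsolutelyContinuousOnInterval f a b)
    (h : Set.EqOn f g (Set.uIcc a b)) : AbsolutelyContinuousOnInterval g a b := by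
  rw [absolutelyContinuousOnInterval_iff] at hf ⊢
  intro ε hε
  obtain ⟨δ, hδ, H⟩ := hf ε hε
  refine ⟨δ, hδ, fun I hI hsum => ?_⟩
  convert H I hI hsum using 1
  exact Finset.sum_congr rfl fun i hi => by rw [h (hI.1 i hi).1, h (hI.1 i hi).2]

theorem _root_.AbsolutelyContinuousOnInterval.lipschitz_comp {X Y : Type*} [PseudoMetricSpace X]
    [PseudoMetricSpace Y] {f : ℝ → X} {a b : ℝ} (hf : AbsolutelyContinuousOnInterval f a b)
    {g : X → Y} (hg : LipschitzWith 1 g) :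
    AbsolutelyContinuousOnInterval (fun x => g (f x)) a b := by
  rw [absolutelyContinuousOnInterval_iff] at hf ⊢
  intro ε hε
  obtain ⟨δ, hδ, H⟩ := hf ε hε
  refine ⟨δ, hδ, fun I hI hsum => (Finset.sum_le_sum fun i _ => ?_).trans_lt (H I hI hsum)⟩
  simpa using hg.dist_le_mul (f (I.2 i).1) (f (I.2 i).2)

theorem map_volume_affine {c : ℝ} (hc : c ≠ 0) (b : ℝ) :
    Measure.map (fun x : ℝ => b + c * x) volume = ENNReal.ofReal |c⁻¹| • volume := by
  have : (fun x : ℝ => b + c * x) = (fun x => b + x) ∘ (fun x => c * x) := rfl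
  rw [this, ← Measure.map_map (measurable_const_add b) (measurable_const_mul c),
    Real.map_volume_mul_left hc, Measure.map_smul, map_add_left_eq_self]

theorem memLp_comp_affine {f : ℝ → ℂ} (hf : MemLp f 2 volume) {c : ℝ} (hc : c ≠ 0) (b : ℝ) :
    MemLp (fun x => f (b + c * x)) 2 volume := by
  have h : MemLp f 2 (Measure.map (fun x : ℝ => b + c * x) volume) := by
    rw [map_volume_affine hc]
    exact hf.smul_measure ENNReal.ofReal_ne_top
  exact h.comp_of_map (by fun_prop)

theorem ae_comp_affine {p : ℝ → Prop} (hp : ∀ᵐ x, p x) {c : ℝ} (hc : c ≠ 0) (b : ℝ) :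
    ∀ᵐ x : ℝ, p (b + c * x) := by
  have h : ∀ᵐ x ∂(Measure.map (fun x : ℝ => b + c * x) volume), p x := by
    rw [map_volume_affine hc]
    exact Measure.ae_smul_measure hp _
  exact ae_of_ae_map (by fun_prop) h

/-! ### The Sobolev space -/

section Sobolev

theorem sobolev_ac (y : sobolevZero) : AbsolutelyContinuousOnInterval (y : ℝ → ℂ) 0 1 := y.2.1

theorem memLp_deriv (y : sobolevZero) : MemLp (deriv (y : ℝ → ℂ)) 2 unitMeasure :=
  y.2.2.1

theorem apply_eq_zero (y : sobolevZero) {x : ℝ} (hx : x ∉ Set.Ioo (0 : ℝ) 1) :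
    (y : ℝ → ℂ) x = 0 := y.2.2.2 x hx

theorem deriv_eq_zero (y : sobolevZero) {x : ℝ} (hx : x ∉ Set.Icc (0 : ℝ) 1) :
    deriv (y : ℝ → ℂ) x = 0 := by
  have : (y : ℝ → ℂ) =ᶠ[𝓝 x] fun _ => 0 := by
    filter_upwards [isClosed_Icc.isOpen_compl.mem_nhds hx] with t ht
    exact apply_eq_zero y fun h => ht ⟨h.1.le, h.2.le⟩
  rw [this.deriv_eq, deriv_const]

theorem memLp_deriv_volume (y : sobolevZero) :
    MemLp (deriv (y : ℝ → ℂ)) 2 volume := by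
  have h : (Set.Icc (0 : ℝ) 1).indicator (deriv (y : ℝ → ℂ)) = deriv (y : ℝ → ℂ) := by
    rw [Set.indicator_eq_self]
    intro x hx
    by_contra hx'
    exact hx (deriv_eq_zero y hx')
  rw [← h, memLp_indicator_iff_restrict measurableSet_Icc]
  exact memLp_deriv y

theorem deriv_add_ae (y z : sobolevZero) :
    ∀ᵐ x ∂unitMeasure, deriv ((y + z : sobolevZero) : ℝ → ℂ) x =
      deriv (y : ℝ → ℂ) x + deriv (z : ℝ → ℂ) x := by
  filter_upwards [ae_differentiableAt_of_ac (sobolev_ac y),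
    ae_differentiableAt_of_ac (sobolev_ac z)] with x h1 h2
  exact deriv_add h1 h2

theorem deriv_smul_ae (c : ℂ) (y : sobolevZero) :
    ∀ᵐ x ∂unitMeasure, deriv ((c • y : sobolevZero) : ℝ → ℂ) x = c * deriv (y : ℝ → ℂ) x := by
  filter_upwards [ae_differentiableAt_of_ac (sobolev_ac y)] with x h1
  exact deriv_const_smul c h1

theorem deriv_normSq_ae (y : sobolevZero) :
    ∀ᵐ x ∂unitMeasure, deriv (normSq y : ℝ → ℂ) x =
      deriv (y : ℝ → ℂ) x * starRingEnd ℂ ((y : ℝ → ℂ) x) +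
        (y : ℝ → ℂ) x * starRingEnd ℂ (deriv (y : ℝ → ℂ) x) := by
  filter_upwards [ae_differentiableAt_of_ac (sobolev_ac y)] with x hx
  have h := hx.hasDerivAt.mul hx.hasDerivAt.star
  have he : (normSq y : ℝ → ℂ) = (y : ℝ → ℂ) * fun x => star ((y : ℝ → ℂ) x) := by
    funext x
    simp [normSq, Complex.mul_conj']
  rw [he, h.deriv]
  rfl

theorem integral_unitMeasure (f : ℝ → ℂ) :
    ∫ x in (0 : ℝ)..1, f x = ∫ x, f x ∂unitMeasure := by
  rw [intervalIntegral.integral_of_le zero_le_one, integral_Icc_eq_integral_Ioc]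

theorem intervalIntegrable_deriv (y : sobolevZero) {x : ℝ} (hx : x ∈ Set.Icc (0 : ℝ) 1) :
    IntervalIntegrable (deriv (y : ℝ → ℂ)) volume 0 x := by
  have h : IntervalIntegrable (deriv (y : ℝ → ℂ)) volume 0 1 :=
    (intervalIntegrable_iff_integrableOn_Icc_of_le zero_le_one).mpr
      ((memLp_deriv y).integrable (by norm_num))
  refine h.mono_set ?_
  rw [Set.uIcc_of_le hx.1, Set.uIcc_of_le zero_le_one]
  exact Set.Icc_subset_Icc_right hx.2

theorem integral_deriv_eq (y : sobolevZero) {x : ℝ} (hx : x ∈ Set.Icc (0 : ℝ) 1) :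
    ∫ t in (0 : ℝ)..x, deriv (y : ℝ → ℂ) t = (y : ℝ → ℂ) x := by
  have hac : AbsolutelyContinuousOnInterval (y : ℝ → ℂ) 0 x := (sobolev_ac y).mono (by
    rw [Set.uIcc_of_le hx.1, Set.uIcc_of_le zero_le_one]
    exact Set.Icc_subset_Icc_right hx.2)
  have h0 : (y : ℝ → ℂ) 0 = 0 := apply_eq_zero y (by simp)
  have hd : ∀ᵐ t, t ∈ Set.uIoc 0 x → DifferentiableAt ℝ (y : ℝ → ℂ) t := by
    have := ae_differentiableAt_of_ac (sobolev_ac y)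
    rw [ae_restrict_iff' measurableSet_Icc] at this
    filter_upwards [this] with t ht htx
    rw [Set.uIoc_of_le hx.1] at htx
    exact ht ⟨htx.1.le, htx.2.trans hx.2⟩
  have key : ∀ (L : ℂ →L[ℝ] ℝ), (∀ z, |L z| ≤ ‖z‖) →
      L (∫ t in (0 : ℝ)..x, deriv (y : ℝ → ℂ) t) = L ((y : ℝ → ℂ) x) := by
    intro L hL
    have hL : LipschitzWith 1 L := LipschitzWith.of_dist_le_mul fun u v => by
      simpa [dist_eq_norm, ← map_sub] using hL (u - v)
    have h1 := (hac.lipschitz_comp hL).integral_deriv_eq_sub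
    simp only [h0, map_zero, sub_zero] at h1
    rw [← h1, ← L.intervalIntegral_comp_comm (intervalIntegrable_deriv y hx)]
    refine intervalIntegral.integral_congr_ae (hd.mono fun t ht htx => ?_)
    exact ((L.hasFDerivAt.comp_hasDerivAt t (ht htx).hasDerivAt).deriv).symm
  apply Complex.ext
  · exact key Complex.reCLM Complex.abs_re_le_norm
  · exact key Complex.imCLM Complex.abs_im_le_norm

end Sobolev

/-! ### The quadratic form of the pencil -/

section Pencil

theorem ac_star (y : sobolevZero) :
    AbsolutelyContinuousOnInterval (fun x => starRingEnd ℂ ((y : ℝ → ℂ) x)) 0 1 :=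
  (sobolev_ac y).lipschitz_comp (LipschitzWith.of_dist_le_mul fun u v => by
    simp only [NNReal.coe_one, one_mul]
    exact (dist_star_star u v).le)

theorem memLp_star_deriv (y : sobolevZero) :
    MemLp (fun x => starRingEnd ℂ (deriv (y : ℝ → ℂ) x)) 2 unitMeasure := (memLp_deriv y).star

theorem integrable_deriv_mul (y z : sobolevZero) :
    Integrable (fun x => deriv (y : ℝ → ℂ) x * starRingEnd ℂ (deriv (z : ℝ → ℂ) x))
      unitMeasure :=
  (memLp_deriv y).integrable_mul (memLp_star_deriv z)

variable {P : ℝ → ℝ}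

theorem integrable_weight_mul (hP : MemLp P 2 unitMeasure) (y z : sobolevZero) :
    Integrable (fun x => (P x : ℂ) * (deriv (y : ℝ → ℂ) x * starRingEnd ℂ ((z : ℝ → ℂ) x) +
      (y : ℝ → ℂ) x * starRingEnd ℂ (deriv (z : ℝ → ℂ) x))) unitMeasure := by
  refine MemLp.integrable_mul (p := 2) (q := 2) hP.ofReal ?_
  refine MemLp.add ?_ (memLp_mul_of_ac (sobolev_ac y) (memLp_star_deriv z))
  simpa only [mul_comm] using memLp_mul_of_ac (ac_star z) (memLp_deriv y)

theorem pencil_eq (hP : MemLp P 2 unitMeasure) (lam : ℝ) (y z : sobolevZero) :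
    pencil P lam y z =
      (∫ x, deriv (y : ℝ → ℂ) x * starRingEnd ℂ (deriv (z : ℝ → ℂ) x) ∂unitMeasure) +
        lam * ∫ x, (P x : ℂ) * (deriv (y : ℝ → ℂ) x * starRingEnd ℂ ((z : ℝ → ℂ) x) +
          (y : ℝ → ℂ) x * starRingEnd ℂ (deriv (z : ℝ → ℂ) x)) ∂unitMeasure := by
  rw [pencil, integral_unitMeasure, ← integral_const_mul,
    ← integral_add (integrable_deriv_mul y z) ((integrable_weight_mul hP y z).const_mul _)]
  simp only [mul_assoc]

theorem pencil_integrable (hP : MemLp P 2 unitMeasure) (lam : ℝ) (y z : sobolevZero) :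
    Integrable (fun x =>
      deriv (y : ℝ → ℂ) x * starRingEnd ℂ (deriv (z : ℝ → ℂ) x) +
        (lam : ℂ) * (P x : ℂ) *
          (deriv (y : ℝ → ℂ) x * starRingEnd ℂ ((z : ℝ → ℂ) x) +
            (y : ℝ → ℂ) x * starRingEnd ℂ (deriv (z : ℝ → ℂ) x))) unitMeasure := by
  simp only [mul_assoc]
  exact (integrable_deriv_mul y z).add ((integrable_weight_mul hP y z).const_mul (lam : ℂ))

theorem pencil_conj (lam : ℝ) (y z : sobolevZero) :
    pencil P lam z y = starRingEnd ℂ (pencil P lam y z) := by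
  rw [pencil, pencil, integral_unitMeasure, integral_unitMeasure, ← integral_conj]
  refine integral_congr_ae (Eventually.of_forall fun x => ?_)
  simp only [map_add, map_mul, Complex.conj_conj, Complex.conj_ofReal]
  ring

theorem pencil_add_left (hP : MemLp P 2 unitMeasure) (lam : ℝ) (y y' z : sobolevZero) :
    pencil P lam (y + y') z = pencil P lam y z + pencil P lam y' z := by
  rw [pencil, pencil, pencil, integral_unitMeasure, integral_unitMeasure, integral_unitMeasure,
    ← integral_add (pencil_integrable hP lam y z) (pencil_integrable hP lam y' z)]
  refine integral_congr_ae ?_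
  filter_upwards [deriv_add_ae y y'] with x hx
  rw [hx]
  simp only [Submodule.coe_add, Pi.add_apply]
  ring

theorem pencil_smul_left (lam : ℝ) (c : ℂ) (y z : sobolevZero) :
    pencil P lam (c • y) z = c * pencil P lam y z := by
  rw [pencil, pencil, integral_unitMeasure, integral_unitMeasure, ← integral_const_mul]
  refine integral_congr_ae ?_
  filter_upwards [deriv_smul_ae c y] with x hx
  rw [hx]
  simp only [Submodule.coe_smul, Pi.smul_apply, smul_eq_mul]
  ring

/-- `pencil P lam` as a bundled sesquilinear form, linear in the first argument. -/
noncomputable def pencilForm (hP : MemLp P 2 unitMeasure) (lam : ℝ) :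
    sobolevZero →ₗ[ℂ] sobolevZero →ₗ⋆[ℂ] ℂ :=
  LinearMap.mk₂'ₛₗ (RingHom.id ℂ) (starRingEnd ℂ) (pencil P lam)
    (pencil_add_left hP lam) (fun c y z => pencil_smul_left lam c y z)
    (fun y z z' => by
      rw [pencil_conj, pencil_add_left hP, map_add, ← pencil_conj, ← pencil_conj])
    (fun c y z => by
      rw [pencil_conj, pencil_smul_left, map_mul, ← pencil_conj]; rfl)

theorem pencilForm_apply (hP : MemLp P 2 unitMeasure) (lam : ℝ) (y z : sobolevZero) :
    pencilForm hP lam y z = pencil P lam y z := rfl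

/-- The squared norm `∫ |y'|²` of the Sobolev space. -/
noncomputable def energy (y : sobolevZero) : ℝ := ∫ x, ‖deriv (y : ℝ → ℂ) x‖ ^ 2 ∂unitMeasure

theorem energy_nonneg (y : sobolevZero) : 0 ≤ energy y := integral_nonneg fun _ => by positivity

theorem pencil_self_re (hP : MemLp P 2 unitMeasure) (lam : ℝ) (y : sobolevZero) :
    (pencil P lam y y).re = energy y - lam * (genDeriv P (normSq y)).re := by
  have h1 : ∫ x, deriv (y : ℝ → ℂ) x * starRingEnd ℂ (deriv (y : ℝ → ℂ) x) ∂unitMeasure =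
      (energy y : ℂ) := by
    rw [energy, ← integral_complex_ofReal]
    refine integral_congr_ae (Eventually.of_forall fun x => ?_)
    simp [Complex.mul_conj']
  have h2 : genDeriv P (normSq y) =
      -∫ x, (P x : ℂ) * (deriv (y : ℝ → ℂ) x * starRingEnd ℂ ((y : ℝ → ℂ) x) +
          (y : ℝ → ℂ) x * starRingEnd ℂ (deriv (y : ℝ → ℂ) x)) ∂unitMeasure := by
    rw [genDeriv, integral_unitMeasure]
    congr 1
    refine integral_congr_ae ?_
    filter_upwards [deriv_normSq_ae y] with x hx
    rw [hx]
    simp only [map_add, map_mul, Complex.conj_conj]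
    ring
  rw [pencil_eq hP, h1]
  rw [eq_neg_iff_add_eq_zero, add_comm, ← eq_neg_iff_add_eq_zero] at h2
  rw [h2, Complex.add_re, Complex.ofReal_re, Complex.re_ofReal_mul, Complex.neg_re]
  ring

/-- The energy is nonnegative, so a vector on which the form is negative keeps this property when
`lam` grows in modulus. -/
theorem ind_le_ind_mul (hP : MemLp P 2 unitMeasure) (lam : ℝ) {c : ℝ} (hc : 1 ≤ c) :
    ind P lam ≤ ind P (c * lam) := by
  refine iSup₂_le fun M hM => le_iSup₂_of_le M ⟨hM.1, fun y hy h0 => ?_⟩ le_rfl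
  have h := hM.2 y hy h0
  rw [pencil_self_re hP] at h ⊢
  have := energy_nonneg y
  nlinarith

theorem norm_le_integral_norm_deriv (y : sobolevZero) (x : ℝ) :
    ‖(y : ℝ → ℂ) x‖ ≤ ∫ t, ‖deriv (y : ℝ → ℂ) t‖ ∂unitMeasure := by
  by_cases hx : x ∈ Set.Icc (0 : ℝ) 1
  · rw [← integral_deriv_eq y hx, intervalIntegral.integral_of_le hx.1]
    refine (norm_integral_le_integral_norm _).trans ?_
    refine setIntegral_mono_set ((memLp_deriv y).integrable (by norm_num)).norm
      (Eventually.of_forall fun t => norm_nonneg _) (LE.le.eventuallyLE ?_)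
    exact fun t ht => ⟨ht.1.le, ht.2.trans hx.2⟩
  · rw [apply_eq_zero y fun h => hx ⟨h.1.le, h.2.le⟩, norm_zero]
    exact integral_nonneg fun t => norm_nonneg _

theorem integral_mul_norm_deriv_le {g : ℝ → ℝ} (hg : MemLp g 2 unitMeasure) (y : sobolevZero) :
    ∫ t, |g t| * ‖deriv (y : ℝ → ℂ) t‖ ∂unitMeasure ≤
      √(∫ t, |g t| ^ 2 ∂unitMeasure) * √(energy y) := by
  have h := integral_mul_le_Lp_mul_Lq_of_nonneg (μ := unitMeasure) Real.HolderConjugate.two_two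
    (f := fun t => |g t|) (g := fun t => ‖deriv (y : ℝ → ℂ) t‖)
    (Eventually.of_forall fun t => abs_nonneg _) (Eventually.of_forall fun t => norm_nonneg _)
    (by rw [ENNReal.ofReal_ofNat]; exact hg.abs)
    (by rw [ENNReal.ofReal_ofNat]; exact (memLp_deriv y).norm)
  simpa only [Real.sqrt_eq_rpow, energy, Real.rpow_two] using h

/-- The weight is bounded relative to the energy. -/
theorem exists_abs_genDeriv_le (hP : MemLp P 2 unitMeasure) :
    ∃ C : ℝ, 0 < C ∧ ∀ y, |(genDeriv P (normSq y)).re| ≤ C * energy y := by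
  set A := √(∫ t, |P t| ^ 2 ∂unitMeasure) with hA
  refine ⟨2 * A + 1, by positivity, fun y => ?_⟩
  set s := ∫ t, ‖deriv (y : ℝ → ℂ) t‖ ∂unitMeasure with hs
  have hs0 : 0 ≤ s := integral_nonneg fun t => norm_nonneg _
  have hs1 : s ≤ √(energy y) := by
    have h := integral_mul_norm_deriv_le (g := fun _ => 1) (memLp_const 1) y
    simpa using h
  have hPI : ∫ t, |P t| * ‖deriv (y : ℝ → ℂ) t‖ ∂unitMeasure ≤ A * √(energy y) :=
    integral_mul_norm_deriv_le hP y
  have hint : Integrable (fun t => |P t| * ‖deriv (y : ℝ → ℂ) t‖) unitMeasure :=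
    MemLp.integrable_mul (p := 2) (q := 2) hP.abs (memLp_deriv y).norm
  have h1 : ‖genDeriv P (normSq y)‖ ≤
      ∫ t, (2 * s) * (|P t| * ‖deriv (y : ℝ → ℂ) t‖) ∂unitMeasure := by
    rw [genDeriv, norm_neg, integral_unitMeasure]
    refine norm_integral_le_of_norm_le (hint.const_mul _) ?_
    filter_upwards [deriv_normSq_ae y] with t ht
    rw [ht, norm_mul, RCLike.norm_conj, Complex.norm_real, Real.norm_eq_abs]
    have h2 := norm_le_integral_norm_deriv y t
    have h3 : ‖deriv (y : ℝ → ℂ) t * starRingEnd ℂ ((y : ℝ → ℂ) t) +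
        (y : ℝ → ℂ) t * starRingEnd ℂ (deriv (y : ℝ → ℂ) t)‖ ≤
        2 * s * ‖deriv (y : ℝ → ℂ) t‖ := by
      refine (norm_add_le _ _).trans ?_
      rw [norm_mul, norm_mul, RCLike.norm_conj, RCLike.norm_conj]
      nlinarith [norm_nonneg (deriv (y : ℝ → ℂ) t)]
    calc _ ≤ |P t| * (2 * s * ‖deriv (y : ℝ → ℂ) t‖) := by gcongr
      _ = _ := by ring
  rw [integral_const_mul] at h1
  have hE := Real.mul_self_sqrt (energy_nonneg y)
  have hr := Real.sqrt_nonneg (energy y)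
  calc |(genDeriv P (normSq y)).re| ≤ ‖genDeriv P (normSq y)‖ := Complex.abs_re_le_norm _
    _ ≤ 2 * s * ∫ t, |P t| * ‖deriv (y : ℝ → ℂ) t‖ ∂unitMeasure := h1
    _ ≤ 2 * √(energy y) * (A * √(energy y)) := by gcongr
    _ = 2 * A * (√(energy y) * √(energy y)) := by ring
    _ = 2 * A * energy y := by rw [hE]
    _ ≤ (2 * A + 1) * energy y := by nlinarith [energy_nonneg y]

theorem exists_ind_eq_zero (hP : MemLp P 2 unitMeasure) :
    ∃ lam₀ : ℝ, 0 < lam₀ ∧ ∀ lam : ℝ, |lam| ≤ lam₀ → ind P lam = 0 := by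
  obtain ⟨C, hC, h⟩ := exists_abs_genDeriv_le hP
  refine ⟨C⁻¹, by positivity, fun lam hlam => ?_⟩
  have hle := negIndex_le_finrank (F := pencil P lam) (0 : sobolevZero →ₗ[ℂ] (Fin 0 → ℂ))
    (fun y _ => by
      rw [pencil_self_re hP, sub_nonneg]
      calc lam * (genDeriv P (normSq y)).re ≤ |lam * (genDeriv P (normSq y)).re| := le_abs_self _
        _ = |lam| * |(genDeriv P (normSq y)).re| := abs_mul _ _
        _ ≤ C⁻¹ * (C * energy y) := by
          have := h y
          gcongr
        _ = energy y := by field_simp)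
  simpa [ind] using hle

end Pencil

/-! ### Cutting the interval and rescaling the pieces -/

section Pieces

theorem deriv_comp_affine (f : ℝ → ℂ) (b c x : ℝ) :
    deriv (fun x => f (b + c * x)) x = c * deriv f (b + c * x) := by
  have h := deriv_comp_mul_left c (fun u => f (b + u)) x
  rw [deriv_comp_const_add] at h
  simpa using h

/-- The piece of `f` on `(α, α + a)`, stretched to `(0, 1)`. -/
noncomputable def stretch (α a : ℝ) : (ℝ → ℂ) →ₗ[ℂ] (ℝ → ℂ) where
  toFun f := (Set.Ioo (0 : ℝ) 1).indicator fun t => f (α + a * t)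
  map_add' f g := by
    ext t
    by_cases ht : t ∈ Set.Ioo (0 : ℝ) 1 <;> simp [ht]
  map_smul' c f := by
    ext t
    by_cases ht : t ∈ Set.Ioo (0 : ℝ) 1 <;> simp [ht]

theorem stretch_apply {α a t : ℝ} (f : ℝ → ℂ) (ht : t ∈ Set.Ioo (0 : ℝ) 1) :
    stretch α a f t = f (α + a * t) := by
  rw [stretch, LinearMap.coe_mk, AddHom.coe_mk, Set.indicator_of_mem ht]

theorem stretch_apply_of_notMem {α a t : ℝ} (f : ℝ → ℂ) (ht : t ∉ Set.Ioo (0 : ℝ) 1) :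
    stretch α a f t = 0 := by
  rw [stretch, LinearMap.coe_mk, AddHom.coe_mk, Set.indicator_of_notMem ht]

theorem deriv_stretch {α a t : ℝ} (f : ℝ → ℂ) (ht : t ∈ Set.Ioo (0 : ℝ) 1) :
    deriv (stretch α a f) t = a * deriv f (α + a * t) := by
  have h : stretch α a f =ᶠ[𝓝 t] fun t => f (α + a * t) := by
    filter_upwards [isOpen_Ioo.mem_nhds ht] with x hx
    exact stretch_apply f hx
  rw [h.deriv_eq, deriv_comp_affine]

theorem ae_mem_Ioo : ∀ᵐ t ∂unitMeasure, t ∈ Set.Ioo (0 : ℝ) 1 := by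
  rw [show unitMeasure = volume.restrict (Set.Ioo (0 : ℝ) 1) from
    restrict_Ioo_eq_restrict_Icc.symm]
  exact ae_restrict_mem measurableSet_Ioo

theorem lipschitzWith_affine (a α : ℝ) : LipschitzWith ‖a‖₊ fun t : ℝ => α + a * t :=
  LipschitzWith.of_dist_le_mul fun x y => by
    rw [Real.dist_eq, Real.dist_eq, coe_nnnorm, Real.norm_eq_abs, ← abs_mul]
    apply le_of_eq
    congr 1
    ring

theorem stretch_mem {α a : ℝ} (ha : 0 < a) (h0 : 0 ≤ α) (h1 : α + a ≤ 1) {y : sobolevZero}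
    (hy0 : (y : ℝ → ℂ) α = 0) (hy1 : (y : ℝ → ℂ) (α + a) = 0) :
    stretch α a y ∈ sobolevZero := by
  refine ⟨?_, ?_, fun x hx => stretch_apply_of_notMem _ hx⟩
  · refine ((sobolev_ac y).comp_monotone (a := 0) (b := 1) (φ := fun t => α + a * t) (K := ‖a‖₊)
      (fun s t hst => ?_) (lipschitzWith_affine a α) fun x hx => ?_).congr fun x hx => ?_
    · have := mul_le_mul_of_nonneg_left hst ha.le
      exact add_le_add le_rfl this
    · rw [Set.uIcc_of_le zero_le_one] at hx ⊢
      exact ⟨by nlinarith [hx.1, hx.2], by nlinarith [hx.1, hx.2]⟩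
    · rw [Set.uIcc_of_le zero_le_one] at hx
      by_cases hx' : x ∈ Set.Ioo (0 : ℝ) 1
      · exact (stretch_apply _ hx').symm
      · rw [stretch_apply_of_notMem _ hx']
        dsimp only
        rcases eq_or_lt_of_le hx.1 with h | h
        · rw [← h, mul_zero, add_zero, hy0]
        · rw [le_antisymm hx.2 (not_lt.mp fun h' => hx' ⟨h, h'⟩), mul_one, hy1]
  · have h := ((memLp_comp_affine (memLp_deriv_volume y) ha.ne' α).const_mul
      (a : ℂ)).restrict (Set.Icc (0 : ℝ) 1)
    refine h.ae_eq ?_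
    filter_upwards [ae_mem_Ioo] with t ht
    exact (deriv_stretch _ ht).symm

/-- The copy of `z` compressed from `(0, 1)` to `(α, α + a)`. -/
noncomputable def compress (α a : ℝ) : (ℝ → ℂ) →ₗ[ℂ] (ℝ → ℂ) where
  toFun z x := z (-(α / a) + a⁻¹ * x)
  map_add' _ _ := rfl
  map_smul' _ _ := rfl

theorem compress_apply (α a : ℝ) (z : ℝ → ℂ) (x : ℝ) :
    compress α a z x = z (-(α / a) + a⁻¹ * x) := rfl

theorem compress_eq_zero {α a x : ℝ} (ha : 0 < a) (z : sobolevZero)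
    (hx : x ∉ Set.Ioo α (α + a)) : compress α a z x = 0 := by
  refine apply_eq_zero z fun h => hx ?_
  have e : -(α / a) + a⁻¹ * x = (x - α) / a := by field_simp; ring
  rw [e, Set.mem_Ioo, div_pos_iff_of_pos_right ha, div_lt_one ha] at h
  exact ⟨by linarith [h.1], by linarith [h.2]⟩

theorem compress_mem {α a : ℝ} (ha : 0 < a) (h0 : 0 ≤ α) (h1 : α + a ≤ 1) (z : sobolevZero) :
    compress α a z ∈ sobolevZero := by
  refine ⟨?_, ?_, fun x hx => compress_eq_zero ha z fun h => hx ⟨by linarith [h.1],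
    by linarith [h.2]⟩⟩
  · -- Since `z` vanishes outside `(0, 1)`, the argument may be clamped to `[0, 1]`.
    refine ((sobolev_ac z).comp_monotone (a := 0) (b := 1)
      (φ := fun x => max 0 (min 1 (-(α / a) + a⁻¹ * x))) (K := ‖a⁻¹‖₊)
      (fun s t hst => ?_) ?_ fun x hx => ?_).congr fun x hx => ?_
    · have := mul_le_mul_of_nonneg_left hst (inv_pos.mpr ha).le
      exact max_le_max le_rfl (min_le_min le_rfl (add_le_add le_rfl this))
    · exact ((lipschitzWith_affine a⁻¹ (-(α / a))).const_min 1).const_max 0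
    · rw [Set.uIcc_of_le zero_le_one]
      exact ⟨le_max_left _ _, max_le zero_le_one (min_le_left _ _)⟩
    · rw [compress_apply]
      dsimp only
      generalize -(α / a) + a⁻¹ * x = u
      by_cases hu : u ∈ Set.Ioo (0 : ℝ) 1
      · rw [min_eq_right hu.2.le, max_eq_right hu.1.le]
      · rw [apply_eq_zero z hu]
        refine apply_eq_zero z fun h => hu ⟨?_, ?_⟩
        · have := h.1
          rw [lt_max_iff] at this
          exact (lt_min_iff.mp (this.resolve_left (lt_irrefl _))).2
        · have := (max_lt_iff.mp h.2).2
          rw [min_lt_iff] at this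
          exact this.resolve_left (lt_irrefl _)
  · have h := ((memLp_comp_affine (memLp_deriv_volume z) (inv_pos.mpr ha).ne'
      (-(α / a))).const_mul ((a⁻¹ : ℝ) : ℂ)).restrict (Set.Icc (0 : ℝ) 1)
    refine h.ae_eq (Eventually.of_forall fun t => ?_)
    exact (deriv_comp_affine _ _ _ _).symm

variable {n : ℕ} {a : Fin n → ℝ}

/-- The sum of the first `m` numbers, extended to all natural `m`. -/
def partialSum (a : Fin n → ℝ) (m : ℕ) : ℝ := ∑ j : Fin n with j.val < m, a j

theorem leftEnd_eq (a : Fin n → ℝ) (k : Fin n) : leftEnd a k = partialSum a k := by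
  rw [leftEnd, partialSum]
  congr 1
  ext j
  simp

theorem leftEnd_add_eq (a : Fin n → ℝ) (k : Fin n) :
    leftEnd a k + a k = partialSum a (k + 1) := by
  rw [leftEnd, partialSum, add_comm, ← Finset.sum_insert (by simp)]
  congr 1
  ext j
  simp only [Finset.mem_insert, Finset.mem_Iio, Finset.mem_filter, Finset.mem_univ, true_and,
    Fin.lt_def, Fin.ext_iff]
  omega

theorem partialSum_mono (ha : ∀ k, 0 < a k) : Monotone (partialSum a) := fun i j hij =>
  Finset.sum_le_sum_of_subset_of_nonneg
    (fun k hk => by simp only [Finset.mem_filter, Finset.mem_univ, true_and] at hk ⊢; omega)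
    fun k _ _ => (ha k).le

theorem partialSum_zero : partialSum a 0 = 0 := by simp [partialSum]

theorem partialSum_self : partialSum a n = ∑ k, a k := by simp [partialSum]

theorem leftEnd_nonneg (ha : ∀ k, 0 < a k) (k : Fin n) : 0 ≤ leftEnd a k :=
  Finset.sum_nonneg fun j _ => (ha j).le

theorem leftEnd_add_le (ha : ∀ k, 0 < a k) (h1 : ∑ k, a k = 1) (k : Fin n) :
    leftEnd a k + a k ≤ 1 := by
  rw [leftEnd_add_eq, ← h1, ← partialSum_self]
  exact partialSum_mono ha (by omega)

theorem leftEnd_add_le_leftEnd (ha : ∀ k, 0 < a k) {k j : Fin n} (h : k < j) :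
    leftEnd a k + a k ≤ leftEnd a j := by
  rw [leftEnd_add_eq, leftEnd_eq]
  exact partialSum_mono ha h

/-- The closure of one interval of the partition misses the other open intervals. -/
theorem notMem_Ioo_of_ne (ha : ∀ k, 0 < a k) {k j : Fin n} (h : k ≠ j) {x : ℝ}
    (hx : x ∈ Set.Icc (leftEnd a k) (leftEnd a k + a k)) :
    x ∉ Set.Ioo (leftEnd a j) (leftEnd a j + a j) := by
  intro hx'
  rcases lt_or_gt_of_ne h with h | h
  · linarith [leftEnd_add_le_leftEnd ha h, hx.2, hx'.1]
  · linarith [leftEnd_add_le_leftEnd ha h, hx.1, hx'.2]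

theorem similarityOp_apply (ha : ∀ k, 0 < a k) (d β : Fin n → ℝ) (f : ℝ → ℝ) {k : Fin n} {x : ℝ}
    (hx : x ∈ Set.Ioo (leftEnd a k) (leftEnd a k + a k)) :
    similarityOp a d β f x = d k * f ((x - leftEnd a k) / a k) + β k := by
  rw [similarityOp, Finset.sum_eq_single k (fun j _ hj => ?_) (by simp)]
  · rw [Set.indicator_of_mem hx]
  · exact Set.indicator_of_notMem (notMem_Ioo_of_ne ha hj.symm ⟨hx.1.le, hx.2.le⟩) _

/-- The values at the ends of the intervals of the partition. -/
def nodeValues (a : Fin n → ℝ) : sobolevZero →ₗ[ℂ] (Fin n → ℂ × ℂ) where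
  toFun y k := ((y : ℝ → ℂ) (leftEnd a k), (y : ℝ → ℂ) (leftEnd a k + a k))
  map_add' _ _ := rfl
  map_smul' _ _ := rfl

/-- The `k`-th piece of a function vanishing at the nodes, stretched to `[0, 1]`. -/
noncomputable def piece (ha : ∀ k, 0 < a k) (h1 : ∑ k, a k = 1) (k : Fin n) :
    LinearMap.ker (nodeValues a) →ₗ[ℂ] sobolevZero :=
  (stretch (leftEnd a k) (a k) ∘ₗ sobolevZero.subtype ∘ₗ
    (LinearMap.ker (nodeValues a)).subtype).codRestrict sobolevZero fun y =>
      have h := Prod.mk_eq_zero.mp (congrFun (LinearMap.mem_ker.mp y.2) k)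
      stretch_mem (ha k) (leftEnd_nonneg ha k) (leftEnd_add_le ha h1 k) h.1 h.2

theorem coe_piece (ha : ∀ k, 0 < a k) (h1 : ∑ k, a k = 1) (k : Fin n)
    (y : LinearMap.ker (nodeValues a)) :
    (piece ha h1 k y : ℝ → ℂ) = stretch (leftEnd a k) (a k) (y : sobolevZero) := rfl

/-- Compressing `n` functions to the intervals of the partition and gluing them together. -/
noncomputable def glue (ha : ∀ k, 0 < a k) (h1 : ∑ k, a k = 1) :
    (Fin n → sobolevZero) →ₗ[ℂ] sobolevZero :=
  ∑ k, ((compress (leftEnd a k) (a k) ∘ₗ sobolevZero.subtype).codRestrict sobolevZero fun z =>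
    compress_mem (ha k) (leftEnd_nonneg ha k) (leftEnd_add_le ha h1 k) z) ∘ₗ LinearMap.proj k

theorem glue_apply (ha : ∀ k, 0 < a k) (h1 : ∑ k, a k = 1) (z : Fin n → sobolevZero) (x : ℝ) :
    (glue ha h1 z : ℝ → ℂ) x = ∑ k, compress (leftEnd a k) (a k) (z k) x := by
  rw [glue, LinearMap.sum_apply, ← Submodule.subtype_apply, map_sum, Finset.sum_apply]
  rfl

theorem glue_apply_of_mem (ha : ∀ k, 0 < a k) (h1 : ∑ k, a k = 1) (z : Fin n → sobolevZero)
    {k : Fin n} {x : ℝ} (hx : x ∈ Set.Icc (leftEnd a k) (leftEnd a k + a k)) :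
    (glue ha h1 z : ℝ → ℂ) x = compress (leftEnd a k) (a k) (z k) x := by
  rw [glue_apply, Finset.sum_eq_single k (fun j _ hj => ?_) (by simp)]
  exact compress_eq_zero (ha j) _ (notMem_Ioo_of_ne ha hj.symm hx)

theorem glue_mem_ker (ha : ∀ k, 0 < a k) (h1 : ∑ k, a k = 1) (z : Fin n → sobolevZero) :
    glue ha h1 z ∈ LinearMap.ker (nodeValues a) := by
  rw [LinearMap.mem_ker]
  funext k
  refine Prod.mk_eq_zero.mpr ⟨?_, ?_⟩
  · rw [glue_apply_of_mem ha h1 z (k := k) ⟨le_rfl, by linarith [ha k]⟩]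
    exact compress_eq_zero (ha k) _ fun h => lt_irrefl _ h.1
  · rw [glue_apply_of_mem ha h1 z (k := k) ⟨by linarith [ha k], le_rfl⟩]
    exact compress_eq_zero (ha k) _ fun h => lt_irrefl _ h.2

theorem piece_glue (ha : ∀ k, 0 < a k) (h1 : ∑ k, a k = 1) (z : Fin n → sobolevZero)
    (k : Fin n) : piece ha h1 k ⟨glue ha h1 z, glue_mem_ker ha h1 z⟩ = z k := by
  apply Subtype.ext
  funext t
  rw [coe_piece]
  by_cases ht : t ∈ Set.Ioo (0 : ℝ) 1
  · have hk := ha k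
    rw [stretch_apply _ ht]
    dsimp only
    rw [glue_apply_of_mem ha h1 z (k := k)
      ⟨by nlinarith [ht.1, ht.2], by nlinarith [ht.1, ht.2]⟩, compress_apply]
    rw [mul_add, inv_mul_cancel_left₀ hk.ne', div_eq_inv_mul, neg_add_cancel_left]
  · rw [apply_eq_zero (z k) ht]
    exact stretch_apply_of_notMem _ ht

theorem integral_eq_sum_pieces (ha : ∀ k, 0 < a k) (h1 : ∑ k, a k = 1) {f : ℝ → ℂ}
    (hf : Integrable f unitMeasure) :
    ∫ x in (0 : ℝ)..1, f x = ∑ k, (a k : ℂ) * ∫ t in (0 : ℝ)..1, f (leftEnd a k + a k * t) := by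
  have hint : IntervalIntegrable f volume 0 1 :=
    (intervalIntegrable_iff_integrableOn_Icc_of_le zero_le_one).mpr hf
  have hsum := intervalIntegral.sum_integral_adjacent_intervals (f := f) (μ := volume)
    (a := partialSum a) (n := n) (fun k hk => hint.mono_set (by
      have hm := partialSum_mono ha
      have h2 : 0 ≤ partialSum a k := by
        rw [← partialSum_zero (a := a)]; exact hm (Nat.zero_le k)
      have h3 : partialSum a (k + 1) ≤ 1 := by
        rw [← h1, ← partialSum_self]; exact hm hk
      rw [Set.uIcc_of_le (hm (Nat.le_succ k)), Set.uIcc_of_le zero_le_one]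
      exact Set.Icc_subset_Icc h2 h3))
  rw [partialSum_zero, partialSum_self, h1] at hsum
  rw [← hsum, Finset.sum_range]
  refine Finset.sum_congr rfl fun k _ => ?_
  have hk := (ha k).ne'
  rw [intervalIntegral.integral_comp_add_mul f hk, mul_zero, add_zero, mul_one, ← leftEnd_eq,
    ← leftEnd_add_eq, Complex.real_smul, Complex.ofReal_inv, mul_inv_cancel_left₀]
  exact_mod_cast hk

variable {d β : Fin n → ℝ} {P : ℝ → ℝ}

theorem ae_self_similar (hP : IsSelfSimilar a d β P) (k : Fin n) :
    ∀ᵐ t ∂unitMeasure, P (leftEnd a k + a k * t) = d k * P t + β k := by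
  have h := hP.fixed
  rw [EventuallyEq, ae_restrict_iff' measurableSet_Icc] at h
  have ha := hP.a_pos
  have hk := ha k
  filter_upwards [ae_restrict_of_ae (ae_comp_affine h hk.ne' (leftEnd a k)), ae_mem_Ioo]
    with t ht ht'
  have hx : leftEnd a k + a k * t ∈ Set.Ioo (leftEnd a k) (leftEnd a k + a k) :=
    ⟨by nlinarith [ht'.1], by nlinarith [ht'.2]⟩
  rw [ht ⟨by linarith [leftEnd_nonneg ha k, hx.1], by linarith [leftEnd_add_le ha hP.sum_a k, hx.2]⟩,
    similarityOp_apply ha d β P hx, add_sub_cancel_left, mul_div_cancel_left₀ _ hk.ne']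

/-- On functions vanishing at the nodes the form of the pencil is a sum of rescaled copies of
itself. The shifts `β_k` drop out because `∫ (|y|²)' = 0` on each piece. -/
theorem pencil_eq_sum (hP : IsSelfSimilar a d β P) (lam : ℝ)
    (y : LinearMap.ker (nodeValues a)) :
    pencil P lam y y = ∑ k, (((a k)⁻¹ : ℝ) : ℂ) *
      pencil P (a k * d k * lam) (piece hP.a_pos hP.sum_a k y) (piece hP.a_pos hP.sum_a k y) := by
  rw [pencil, integral_eq_sum_pieces hP.a_pos hP.sum_a (pencil_integrable hP.memLp lam y y)]
  refine Finset.sum_congr rfl fun k _ => ?_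
  set z := piece hP.a_pos hP.sum_a k y with hz
  have hk : (a k : ℂ) ≠ 0 := by exact_mod_cast (hP.a_pos k).ne'
  have h0 : ∫ t, deriv (normSq z : ℝ → ℂ) t ∂unitMeasure = 0 := by
    rw [← integral_unitMeasure, integral_deriv_eq _ ⟨zero_le_one, le_rfl⟩]
    exact apply_eq_zero _ (by simp)
  have hN : Integrable (deriv (normSq z : ℝ → ℂ)) unitMeasure :=
    (memLp_deriv (normSq z)).integrable (by norm_num)
  have h2 : ∫ t, ((((a k)⁻¹ : ℝ) : ℂ) ^ 2 * (deriv (z : ℝ → ℂ) t *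
      starRingEnd ℂ (deriv (z : ℝ → ℂ) t) + ((a k * d k * lam : ℝ) : ℂ) * (P t : ℂ) *
        (deriv (z : ℝ → ℂ) t * starRingEnd ℂ ((z : ℝ → ℂ) t) +
          (z : ℝ → ℂ) t * starRingEnd ℂ (deriv (z : ℝ → ℂ) t))) +
      (lam * β k * (a k)⁻¹ : ℂ) * deriv (normSq z : ℝ → ℂ) t) ∂unitMeasure =
      (((a k)⁻¹ : ℝ) : ℂ) ^ 2 * pencil P (a k * d k * lam) z z := by
    rw [integral_add ((pencil_integrable hP.memLp _ z z).const_mul _) (hN.const_mul _),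
      integral_const_mul, integral_const_mul, h0, mul_zero, add_zero, pencil, integral_unitMeasure]
  have h3 : ∀ w : ℂ, (((a k)⁻¹ : ℝ) : ℂ) * w = a k * ((((a k)⁻¹ : ℝ) : ℂ) ^ 2 * w) := by
    intro w
    push_cast
    field_simp
  rw [h3, ← h2, integral_unitMeasure]
  congr 1
  refine integral_congr_ae ?_
  filter_upwards [ae_self_similar hP k, ae_mem_Ioo, deriv_normSq_ae z] with t h4 ht h5
  have h6 : (z : ℝ → ℂ) t = (y : ℝ → ℂ) (leftEnd a k + a k * t) := stretch_apply _ ht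
  have h7 : deriv (z : ℝ → ℂ) t = a k * deriv (y : ℝ → ℂ) (leftEnd a k + a k * t) :=
    deriv_stretch _ ht
  rw [h5, h4, h6, h7]
  simp only [map_mul, Complex.conj_ofReal]
  push_cast
  field_simp
  ring

end Pieces

/-! ### Growth bounds and convergence for renewal systems of counting functions -/

section Growth

variable {ι : Type*} [Fintype ι] {τ : ι → ℝ} {e : ι → Bool} {γ : ℝ} {N : Bool → ℝ → ℝ}

theorem exists_pos_le_of_sum_exp (hτ : ∀ k, 0 < τ k) (hsum : ∑ k, Real.exp (-γ * τ k) = 1) :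
    ∃ δ : ℝ, 0 < δ ∧ ∀ k, δ ≤ τ k := by
  have : Nonempty ι := by
    by_contra h
    rw [not_nonempty_iff] at h
    simp at hsum
  obtain ⟨k, hk⟩ := Finite.exists_min τ
  exact ⟨τ k, hτ k, hk⟩

theorem le_sum_of_pos (hτ : ∀ k, 0 < τ k) (k : ι) : τ k ≤ ∑ j, τ j :=
  Finset.single_le_sum (fun j _ => (hτ j).le) (Finset.mem_univ k)

theorem sum_exp_shift (hsum : ∑ k, Real.exp (-γ * τ k) = 1) (t : ℝ) :
    ∑ k, Real.exp (γ * (t - τ k)) = Real.exp (γ * t) := by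
  have h : ∀ k, Real.exp (γ * (t - τ k)) = Real.exp (-γ * τ k) * Real.exp (γ * t) := fun k => by
    rw [← Real.exp_add]
    congr 1
    ring
  simp only [h]
  rw [← Finset.sum_mul, hsum, one_mul]

/-- A subadditive renewal system has at most exponential growth with the exponent `γ` of the
exact equation. -/
theorem exists_le_exp (hγ : 0 < γ) (hτ : ∀ k, 0 < τ k) (hsum : ∑ k, Real.exp (-γ * τ k) = 1)
    {κ : ℝ} (hκ : 0 ≤ κ) {t₀ : ℝ} (h0 : ∀ σ t, t ≤ t₀ → N σ t = 0)
    (hN : ∀ σ t, N σ t ≤ ∑ k, N (xor σ (e k)) (t - τ k) + κ) :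
    ∃ C : ℝ, 0 ≤ C ∧ ∀ σ t, N σ t ≤ C * Real.exp (γ * t) := by
  obtain ⟨δ, hδ, hδτ⟩ := exists_pos_le_of_sum_exp hτ hsum
  -- At least two steps occur, since each weight is less than one.
  have hcard : (2 : ℝ) ≤ Fintype.card ι := by
    have hne : (Finset.univ : Finset ι).Nonempty := by
      by_contra h
      rw [Finset.not_nonempty_iff_eq_empty] at h
      simp [h] at hsum
    have h1 : ∑ k, Real.exp (-γ * τ k) < ∑ _k : ι, (1 : ℝ) :=
      Finset.sum_lt_sum_of_nonempty hne fun k _ => by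
        rw [Real.exp_lt_one_iff]
        have := mul_pos hγ (hτ k)
        linarith
    rw [hsum, Finset.sum_const, Finset.card_univ, nsmul_eq_mul, mul_one] at h1
    have h2 : 1 < Fintype.card ι := by exact_mod_cast h1
    exact_mod_cast h2
  set T := ∑ k, τ k with hT
  set C := κ * Real.exp (-γ * (t₀ - T)) with hC
  have hC0 : 0 ≤ C := by positivity
  have hCκ : ∀ t, t₀ - T ≤ t → κ ≤ C * Real.exp (γ * t) := by
    intro t ht
    rw [hC, mul_assoc, ← Real.exp_add]
    refine le_mul_of_one_le_right hκ (Real.one_le_exp ?_)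
    nlinarith
  -- Subtracting `κ` makes the bound stable under the inequality, which adds `κ` only once.
  have key : ∀ m : ℕ, ∀ σ t, t₀ - T ≤ t → t ≤ t₀ + m * δ →
      N σ t ≤ C * Real.exp (γ * t) - κ := by
    intro m
    induction m with
    | zero =>
      intro σ t ht1 ht2
      rw [h0 σ t (by simpa using ht2)]
      linarith [hCκ t ht1]
    | succ m ih =>
      intro σ t ht1 ht2
      rcases le_or_gt t t₀ with ht | ht
      · rw [h0 σ t ht]
        linarith [hCκ t ht1]
      · have h1 : ∑ k, N (xor σ (e k)) (t - τ k) ≤ ∑ k, (C * Real.exp (γ * (t - τ k)) - κ) :=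
          Finset.sum_le_sum fun k _ => ih _ _ (by linarith [le_sum_of_pos hτ k]) (by
            push_cast at ht2
            linarith [hδτ k])
        rw [Finset.sum_sub_distrib, ← Finset.mul_sum, sum_exp_shift hsum, Finset.sum_const,
          Finset.card_univ, nsmul_eq_mul] at h1
        have := hN σ t
        nlinarith
  refine ⟨C, hC0, fun σ t => ?_⟩
  rcases le_or_gt t t₀ with ht | ht
  · rw [h0 σ t ht]
    positivity
  · obtain ⟨m, hm⟩ := exists_nat_ge ((t - t₀) / δ)
    rw [div_le_iff₀ hδ] at hm
    have hT0 : 0 ≤ T := Finset.sum_nonneg fun k _ => (hτ k).le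
    linarith [key m σ t (by linarith) (by linarith)]

/-- A component of a superadditive renewal system that is eventually at least one has at least
exponential growth with the exponent `γ`. -/
theorem exists_exp_le (hγ : 0 < γ) (hτ : ∀ k, 0 < τ k) (hsum : ∑ k, Real.exp (-γ * τ k) = 1)
    (hN0 : ∀ σ t, 0 ≤ N σ t) (hN : ∀ σ t, ∑ k, N (xor σ (e k)) (t - τ k) ≤ N σ t)
    {σ : Bool} (hσ : ∃ t₁, ∀ t, t₁ ≤ t → 1 ≤ N σ t) :
    ∃ c : ℝ, 0 < c ∧ ∃ t₁, ∀ t, t₁ ≤ t → c * Real.exp (γ * t) ≤ N σ t := by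
  obtain ⟨δ, hδ, hδτ⟩ := exists_pos_le_of_sum_exp hτ hsum
  -- The components that are eventually at least one are permuted by the steps.
  set S : Bool → Prop := fun σ => ∃ t₁, ∀ t, t₁ ≤ t → 1 ≤ N σ t with hS
  have hstep : ∀ σ k, S σ → S (xor σ (e k)) := by
    rintro σ k ⟨t₁, ht₁⟩
    refine ⟨t₁ + τ k, fun t ht => ?_⟩
    have h1 := ht₁ (t - τ k) (by linarith)
    have h2 : N (xor (xor σ (e k)) (e k)) (t - τ k) ≤ _ :=
      (Finset.single_le_sum (f := fun k' => N (xor (xor σ (e k)) (e k')) (t - τ k'))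
        (fun j _ => hN0 _ _) (Finset.mem_univ k)).trans (hN _ t)
    rw [Bool.xor_assoc, Bool.xor_self, Bool.xor_false] at h2
    linarith
  obtain ⟨t₁, ht₁⟩ : ∃ t₁, ∀ σ, S σ → ∀ t, t₁ ≤ t → 1 ≤ N σ t := by
    have : ∀ σ, ∃ t₁, S σ → ∀ t, t₁ ≤ t → 1 ≤ N σ t := fun σ => by
      by_cases h : S σ
      · obtain ⟨t₁, ht₁⟩ := h
        exact ⟨t₁, fun _ => ht₁⟩
      · exact ⟨0, fun h' => absurd h' h⟩
    choose u hu using this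
    exact ⟨max (u false) (u true), fun σ hσ t ht => hu σ hσ t (by
      cases σ
      · exact (le_max_left _ _).trans ht
      · exact (le_max_right _ _).trans ht)⟩
  set T := ∑ k, τ k with hT
  have hT0 : 0 ≤ T := Finset.sum_nonneg fun k _ => (hτ k).le
  set c := Real.exp (-γ * (t₁ + T)) with hc
  have key : ∀ m : ℕ, ∀ σ, S σ → ∀ t, t₁ ≤ t → t ≤ t₁ + T + m * δ →
      c * Real.exp (γ * t) ≤ N σ t := by
    intro m
    have base : ∀ σ, S σ → ∀ t, t₁ ≤ t → t ≤ t₁ + T → c * Real.exp (γ * t) ≤ N σ t := by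
      intro σ hσ t h1 h2
      refine le_trans ?_ (ht₁ σ hσ t h1)
      rw [hc, ← Real.exp_add, Real.exp_le_one_iff]
      nlinarith
    induction m with
    | zero => exact fun σ hσ t h1 h2 => base σ hσ t h1 (by simpa using h2)
    | succ m ih =>
      intro σ hσ t h1 h2
      rcases le_or_gt t (t₁ + T) with ht | ht
      · exact base σ hσ t h1 ht
      · refine le_trans ?_ (hN σ t)
        rw [← sum_exp_shift hsum, Finset.mul_sum]
        refine Finset.sum_le_sum fun k _ => ih _ (hstep σ k hσ) _
          (by linarith [le_sum_of_pos hτ k]) ?_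
        push_cast at h2
        linarith [hδτ k]
  refine ⟨c, Real.exp_pos _, t₁, fun t ht => ?_⟩
  obtain ⟨m, hm⟩ := exists_nat_ge ((t - t₁) / δ)
  rw [div_le_iff₀ hδ] at hm
  exact key m σ hσ t ht (by linarith)

/-- Counting functions satisfying a two-component non-arithmetic renewal system up to a bounded
error grow like `exp (γ t)` times a constant. -/
theorem exists_tendsto_exp_mul (hγ : 0 < γ) (hτ : ∀ k, 0 < τ k)
    (hsum : ∑ k, Real.exp (-γ * τ k) = 1)
    (hna : ¬ ∃ ν : ℝ, 0 < ν ∧ ∀ k, ∃ m : ℤ, τ k = m * ν)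
    (hN0 : ∀ σ t, 0 ≤ N σ t) (hmono : ∀ σ, Monotone (N σ))
    {κ : ℝ} (hκ : 0 ≤ κ) {t₀ : ℝ} (h0 : ∀ σ t, t ≤ t₀ → N σ t = 0)
    (hle : ∀ σ t, N σ t ≤ ∑ k, N (xor σ (e k)) (t - τ k) + κ)
    (hge : ∀ σ t, ∑ k, N (xor σ (e k)) (t - τ k) ≤ N σ t) :
    ∃ s : Bool → ℝ, (∀ σ, Tendsto (fun t => Real.exp (-γ * t) * N σ t) atTop (𝓝 (s σ))) ∧
      ((∃ k, e k = true) → s false = s true) := by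
  obtain ⟨C, hC0, hC⟩ := exists_le_exp hγ hτ hsum hκ h0 hle
  set p : ι → ℝ := fun k => Real.exp (-γ * τ k) with hp
  have hp0 : ∀ k, 0 < p k := fun k => Real.exp_pos _
  set f : Bool → ℝ → ℝ := fun σ t => Real.exp (-γ * t) * N σ t with hf
  have hf0 : ∀ σ t, 0 ≤ f σ t := fun σ t => mul_nonneg (Real.exp_pos _).le (hN0 σ t)
  have hfC' : ∀ σ t, f σ t ≤ C := fun σ t => by
    calc f σ t ≤ Real.exp (-γ * t) * (C * Real.exp (γ * t)) :=
          mul_le_mul_of_nonneg_left (hC σ t) (Real.exp_pos _).le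
      _ = C * (Real.exp (-γ * t) * Real.exp (γ * t)) := by ring
      _ = C := by rw [← Real.exp_add]; simp
  have hfC : ∀ σ t, |f σ t| ≤ C := fun σ t => by
    rw [abs_of_nonneg (hf0 σ t)]
    exact hfC' σ t
  have hfm : ∀ σ, Measurable (f σ) := fun σ =>
    (by fun_prop : Measurable fun t : ℝ => Real.exp (-γ * t)).mul (hmono σ).measurable
  have hslow : ∀ σ t δ, 0 ≤ δ → f σ t - (γ * C) * δ ≤ f σ (t + δ) := by
    intro σ t δ hδ
    have h1 : Real.exp (-γ * δ) * f σ t ≤ f σ (t + δ) := by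
      calc Real.exp (-γ * δ) * f σ t = Real.exp (-γ * (t + δ)) * N σ t := by
            rw [hf]
            dsimp only
            rw [← mul_assoc, ← Real.exp_add]
            congr 2
            ring
        _ ≤ f σ (t + δ) :=
            mul_le_mul_of_nonneg_left (hmono σ (by linarith)) (Real.exp_pos _).le
    have h2 := Real.add_one_le_exp (-γ * δ)
    have h3 : (-γ * δ + 1) * f σ t ≤ Real.exp (-γ * δ) * f σ t :=
      mul_le_mul_of_nonneg_right h2 (hf0 σ t)
    have h4 : γ * δ * f σ t ≤ γ * δ * C := mul_le_mul_of_nonneg_left (hfC' σ t) (by positivity)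
    nlinarith
  have hterm : ∀ σ t, ∑ k, p k * f (xor σ (e k)) (t - τ k) =
      Real.exp (-γ * t) * ∑ k, N (xor σ (e k)) (t - τ k) := by
    intro σ t
    rw [Finset.mul_sum]
    refine Finset.sum_congr rfl fun k _ => ?_
    rw [hp, hf]
    dsimp only
    rw [← mul_assoc, ← Real.exp_add]
    congr 2
    ring
  set g : Bool → ℝ → ℝ := fun σ t => f σ t - ∑ k, p k * f (xor σ (e k)) (t - τ k) with hg
  have hgb : ∀ σ t, ‖g σ t‖ ≤ κ * Real.exp (-γ * t) := by
    intro σ t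
    have h1 : g σ t = Real.exp (-γ * t) * (N σ t - ∑ k, N (xor σ (e k)) (t - τ k)) := by
      rw [hg]
      dsimp only
      rw [hterm, mul_sub]
    rw [h1, norm_mul, Real.norm_of_nonneg (Real.exp_pos _).le,
      Real.norm_of_nonneg (sub_nonneg.mpr (hge σ t)), mul_comm]
    exact mul_le_mul_of_nonneg_right (by linarith [hle σ t]) (Real.exp_pos _).le
  have hg0 : ∀ σ, Tendsto (g σ) atTop (𝓝 0) := by
    intro σ
    refine squeeze_zero_norm (hgb σ) ?_
    have h1 : Tendsto (fun t : ℝ => γ * t) atTop atTop := tendsto_id.const_mul_atTop hγ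
    have h2 := (Real.tendsto_exp_neg_atTop_nhds_zero.comp h1).const_mul κ
    rw [mul_zero] at h2
    refine h2.congr fun t => ?_
    simp
  have hgm : ∀ σ, Measurable (g σ) := fun σ => (hfm σ).sub
    (Finset.measurable_sum _ fun k _ =>
      ((hfm _).comp (measurable_id.sub_const (τ k))).const_mul (p k))
  have hgi : ∀ σ, IntegrableOn (g σ) (Set.Ioi 0) := fun σ =>
    ((exp_neg_integrableOn_Ioi 0 hγ).const_mul κ).mono' (hgm σ).aestronglyMeasurable
      (Eventually.of_forall (hgb σ))
  have hK : 0 ≤ γ * C := by positivity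
  by_cases he : ∃ k, e k = true
  · obtain ⟨k₀, hk₀⟩ := he
    have hFg : (fun t => (f false t + f true t) - ∑ k, p k * (f false (t - τ k) + f true (t - τ k)))
        = fun t => g false t + g true t := by
      funext t
      rw [hg]
      dsimp only
      rw [sub_add_sub_comm, ← Finset.sum_add_distrib]
      congr 1
      refine Finset.sum_congr rfl fun k _ => ?_
      cases e k <;> simp <;> ring
    obtain ⟨s, hs⟩ := exists_tendsto_of_renewal (f := fun t => f false t + f true t)
      (K := 2 * (γ * C)) (C := C + C) hp0 hsum hτ hna (by positivity)
      (fun t δ hδ => by linarith [hslow false t δ hδ, hslow true t δ hδ])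
      ((hfm false).add (hfm true))
      (fun t => (abs_add_le _ _).trans (add_le_add (hfC false t) (hfC true t)))
      (by rw [hFg]; simpa using (hg0 false).add (hg0 true))
      (by rw [hFg]; exact (hgi false).add (hgi true))
    have hlim := tendsto_of_tendsto_add (s := s / 2) hp0 hsum hτ hna hK hslow hfC hg0 hk₀
      (by rwa [mul_div_cancel₀ s two_ne_zero])
    exact ⟨fun _ => s / 2, hlim, fun _ => rfl⟩
  · have he' : ∀ k, e k = false := fun k => by
      by_contra h
      exact he ⟨k, by simpa using h⟩
    have hgf : ∀ σ, (fun t => f σ t - ∑ k, p k * f σ (t - τ k)) = g σ := fun σ => by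
      funext t
      simp only [hg, he', Bool.xor_false]
    choose s hs using fun σ => exists_tendsto_of_renewal (f := f σ) hp0 hsum hτ hna hK (hslow σ)
      (hfm σ) (hfC σ) (by rw [hgf]; exact hg0 σ) (by rw [hgf]; exact hgi σ)
    exact ⟨s, hs, fun h => absurd h he⟩

end Growth

/-! ### The renewal system of the negative index -/

section Counting

variable {n : ℕ} {a d β : Fin n → ℝ} {P : ℝ → ℝ}

theorem mul_abs_lt_one (hP : IsSelfSimilar a d β P) (k : Fin n) : a k * |d k| < 1 := by
  have ha := hP.a_pos
  have h1 : a k ≤ 1 := by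
    rw [← hP.sum_a]
    exact Finset.single_le_sum (fun j _ => (ha j).le) (Finset.mem_univ k)
  have h2 : a k * d k ^ 2 < 1 := lt_of_le_of_lt
    (Finset.single_le_sum (f := fun k => a k * d k ^ 2)
      (fun j _ => mul_nonneg (ha j).le (sq_nonneg _)) (Finset.mem_univ k)) hP.contracting
  have h3 : (a k * |d k|) ^ 2 < 1 := by
    rw [mul_pow, sq_abs, sq, mul_assoc]
    have : 0 ≤ a k * d k ^ 2 := mul_nonneg (ha k).le (sq_nonneg _)
    nlinarith
  exact (pow_lt_one_iff_of_nonneg (mul_nonneg (ha k).le (abs_nonneg _)) two_ne_zero).mp h3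

theorem ind_le_sum (hP : IsSelfSimilar a d β P) {lam : ℝ}
    (hfin : ∀ k, ind P (a k * d k * lam) ≠ ⊤) :
    ind P lam ≤ ((∑ k, (ind P (a k * d k * lam)).toNat + 2 * n : ℕ) : ℕ∞) := by
  have h := negIndex_le_sum_add (F := pencil P lam) (nodeValues a)
    (fun k => pencilForm hP.memLp (a k * d k * lam)) (fun k y z => pencil_conj _ _ _) hfin
    (piece hP.a_pos hP.sum_a) (c := fun k => (a k)⁻¹) (fun k => (inv_pos.mpr (hP.a_pos k)).le)
    (fun y => by
      rw [pencil_eq_sum hP, Complex.re_sum]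
      simp only [Complex.re_ofReal_mul, pencilForm_apply])
  have h2 : Module.finrank ℂ (Fin n → ℂ × ℂ) = 2 * n := by
    rw [Module.finrank_pi_fintype]
    simp [mul_comm]
  rw [h2] at h
  exact h

theorem ind_zero_re (lam : ℝ) : (pencil P lam 0 0).re = 0 := by
  rw [← zero_smul ℂ (0 : sobolevZero), pencil_smul_left, zero_mul, Complex.zero_re]

theorem sum_le_ind (hP : IsSelfSimilar a d β P) {lam : ℝ}
    (hfin : ∀ k, ind P (a k * d k * lam) ≠ ⊤) :
    ((∑ k, (ind P (a k * d k * lam)).toNat : ℕ) : ℕ∞) ≤ ind P lam :=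
  sum_le_negIndex (F := pencil P lam) (ind_zero_re lam)
    (fun k => pencil P (a k * d k * lam)) (fun k => ind_zero_re _) hfin
    (glue hP.a_pos hP.sum_a) (c := fun k => (a k)⁻¹) (fun k => inv_pos.mpr (hP.a_pos k))
    (fun z => by
      have h := pencil_eq_sum hP lam
        ⟨glue hP.a_pos hP.sum_a z, glue_mem_ker hP.a_pos hP.sum_a z⟩
      simp only [piece_glue] at h
      rw [h, Complex.re_sum]
      simp only [Complex.re_ofReal_mul])

/-- The index vanishes near `0` and is finite at `lam` as soon as it is finite at the contracted
points `a_k d_k lam`. -/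
theorem ind_ne_top (hP : IsSelfSimilar a d β P) (lam : ℝ) : ind P lam ≠ ⊤ := by
  obtain ⟨lam₀, hlam₀, h0⟩ := exists_ind_eq_zero hP.memLp
  obtain ⟨r, hr0, hr1, hr⟩ : ∃ r : ℝ, 0 ≤ r ∧ r < 1 ∧ ∀ k, a k * |d k| ≤ r := by
    rcases isEmpty_or_nonempty (Fin n) with h | h
    · exact ⟨0, le_rfl, one_pos, fun k => h.elim k⟩
    · obtain ⟨k, hk⟩ := Finite.exists_max fun k => a k * |d k|
      exact ⟨a k * |d k|, mul_nonneg (hP.a_pos k).le (abs_nonneg _), mul_abs_lt_one hP k, hk⟩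
  have key : ∀ m : ℕ, ∀ lam : ℝ, r ^ m * |lam| ≤ lam₀ → ind P lam ≠ ⊤ := by
    intro m
    induction m with
    | zero =>
      intro lam h
      rw [h0 lam (by simpa using h)]
      exact ENat.zero_ne_top
    | succ m ih =>
      intro lam h
      refine ne_top_of_le_ne_top (ENat.natCast_ne_top _) (ind_le_sum hP fun k => ih _ ?_)
      rw [abs_mul, abs_mul, abs_of_pos (hP.a_pos k)]
      refine le_trans ?_ h
      rw [pow_succ, mul_assoc (r ^ m)]
      exact mul_le_mul_of_nonneg_left (mul_le_mul_of_nonneg_right (hr k) (abs_nonneg _))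
        (pow_nonneg hr0 m)
  have hlim : Tendsto (fun m : ℕ => r ^ m * |lam|) atTop (𝓝 (0 * |lam|)) :=
    (tendsto_pow_atTop_nhds_zero_of_lt_one hr0 hr1).mul_const _
  rw [zero_mul] at hlim
  obtain ⟨m, hm⟩ := (hlim.eventually (gt_mem_nhds hlam₀)).exists
  exact key m lam hm.le

/-- `1` or `-1`, the sign of the spectral parameter. -/
def signOf (σ : Bool) : ℝ := if σ then -1 else 1

theorem abs_signOf (σ : Bool) : |signOf σ| = 1 := by cases σ <;> simp [signOf]

/-- The negative index on the half-line of sign `σ`, in the logarithmic scale. It is finite by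
`ind_ne_top`, so `toNat` loses nothing. -/
noncomputable def logCount (P : ℝ → ℝ) (σ : Bool) (t : ℝ) : ℝ :=
  (ind P (signOf σ * Real.exp t)).toNat

theorem logCount_mono (hP : IsSelfSimilar a d β P) (σ : Bool) : Monotone (logCount P σ) := by
  intro s t hst
  have h := ind_le_ind_mul hP.memLp (signOf σ * Real.exp s) (Real.one_le_exp (sub_nonneg.mpr hst))
  rw [mul_left_comm, ← Real.exp_add, sub_add_cancel] at h
  rw [logCount, logCount]
  exact_mod_cast ENat.toNat_le_toNat h (ind_ne_top hP _)

/-- The length of the `k`-th step of the renewal system. -/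
noncomputable def stepLength (a d : Fin n → ℝ) (k : {k // d k ≠ 0}) : ℝ :=
  -Real.log (a k * |d k|)

/-- Whether the `k`-th step changes the sign of the spectral parameter. -/
noncomputable def stepSign (d : Fin n → ℝ) (k : {k // d k ≠ 0}) : Bool := decide (d k < 0)

theorem exp_neg_mul_stepLength (ha : ∀ k, 0 < a k) (γ : ℝ) (k : {k // d k ≠ 0}) :
    Real.exp (-γ * stepLength a d k) = (a k * |d k|) ^ γ := by
  rw [Real.rpow_def_of_pos (mul_pos (ha k) (abs_pos.mpr k.2)), stepLength]
  congr 1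
  ring

theorem mul_signOf_exp (ha : ∀ k, 0 < a k) (k : {k // d k ≠ 0}) (σ : Bool) (t : ℝ) :
    a k * d k * (signOf σ * Real.exp t) =
      signOf (xor σ (stepSign d k)) * Real.exp (t - stepLength a d k) := by
  rw [stepLength, sub_neg_eq_add, Real.exp_add,
    Real.exp_log (mul_pos (ha k) (abs_pos.mpr k.2)), stepSign]
  rcases lt_or_gt_of_ne k.2 with h | h
  · cases σ <;> simp [signOf, h, abs_of_neg h] <;> ring
  · cases σ <;> simp [signOf, h.not_gt, abs_of_pos h] <;> ring

theorem ind_zero (hP : IsSelfSimilar a d β P) : ind P 0 = 0 := by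
  obtain ⟨lam₀, hlam₀, h0⟩ := exists_ind_eq_zero hP.memLp
  exact h0 0 (by simpa using hlam₀.le)

theorem sum_toNat_ind_eq (hP : IsSelfSimilar a d β P) (σ : Bool) (t : ℝ) :
    ((∑ k, (ind P (a k * d k * (signOf σ * Real.exp t))).toNat : ℕ) : ℝ) =
      ∑ k, logCount P (xor σ (stepSign d k)) (t - stepLength a d k) := by
  have h1 : ∀ k : {k // d k ≠ 0}, logCount P (xor σ (stepSign d k)) (t - stepLength a d k) =
      ((ind P (a k * d k * (signOf σ * Real.exp t))).toNat : ℝ) := fun k => by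
    rw [logCount, mul_signOf_exp hP.a_pos]
  rw [Finset.sum_congr rfl fun k _ => h1 k, Nat.cast_sum, ← Finset.sum_filter_of_ne
    (p := fun k => d k ≠ 0), ← Finset.sum_subtype_eq_sum_filter]
  · exact Finset.sum_congr (by ext; simp) fun _ _ => rfl
  · intro k _ h hd
    rw [hd, mul_zero, zero_mul, ind_zero hP] at h
    simp at h

theorem logCount_le (hP : IsSelfSimilar a d β P) (σ : Bool) (t : ℝ) :
    logCount P σ t ≤
      ∑ k, logCount P (xor σ (stepSign d k)) (t - stepLength a d k) + (2 * n : ℕ) := by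
  rw [← sum_toNat_ind_eq hP, ← Nat.cast_add, logCount, Nat.cast_le]
  simpa only [ENat.toNat_natCast] using
    ENat.toNat_le_toNat (ind_le_sum hP fun k => ind_ne_top hP _) (ENat.natCast_ne_top _)

theorem le_logCount (hP : IsSelfSimilar a d β P) (σ : Bool) (t : ℝ) :
    ∑ k, logCount P (xor σ (stepSign d k)) (t - stepLength a d k) ≤ logCount P σ t := by
  rw [← sum_toNat_ind_eq hP, logCount, Nat.cast_le]
  simpa only [ENat.toNat_natCast] using
    ENat.toNat_le_toNat (sum_le_ind hP fun k => ind_ne_top hP _) (ind_ne_top hP _)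

theorem one_le_ind (hP : MemLp P 2 unitMeasure) {lam : ℝ} {y : sobolevZero}
    (hy : energy y < lam * (genDeriv P (normSq y)).re) : 1 ≤ ind P lam := by
  have h := finrank_le_negIndex (F := pencil P lam) (ind_zero_re lam)
    (LinearMap.toSpanSingleton ℂ sobolevZero y) (fun c hc => by
      rw [LinearMap.toSpanSingleton_apply, pencil_smul_left, pencil_conj, pencil_smul_left,
        map_mul, ← pencil_conj, ← mul_assoc, Complex.mul_conj', ← Complex.ofReal_pow,
        Complex.re_ofReal_mul, pencil_self_re hP]
      have : 0 < ‖c‖ ^ 2 := by positivity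
      nlinarith)
  rw [ind]
  simpa using h

theorem exists_one_le_logCount (hP : IsSelfSimilar a d β P) {σ : Bool} {y : sobolevZero}
    (hy : 0 < signOf σ * (genDeriv P (normSq y)).re) :
    ∃ t₁, ∀ t, t₁ ≤ t → 1 ≤ logCount P σ t := by
  obtain ⟨t₁, ht₁⟩ : ∃ t₁, energy y < Real.exp t₁ * (signOf σ * (genDeriv P (normSq y)).re) :=
    ((Real.tendsto_exp_atTop.atTop_mul_const hy).eventually_gt_atTop _).exists
  refine ⟨t₁, fun t ht => ?_⟩
  have h1 : energy y < signOf σ * Real.exp t * (genDeriv P (normSq y)).re := by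
    have := mul_le_mul_of_nonneg_right (Real.exp_le_exp.mpr ht) hy.le
    nlinarith
  have h2 := ENat.toNat_le_toNat (one_le_ind hP.memLp h1) (ind_ne_top hP _)
  rw [logCount]
  exact_mod_cast h2

theorem exp_mul_logCount_eq {γ lam : ℝ} {σ : Bool} (h : 0 < signOf σ * lam) :
    Real.exp (-γ * Real.log (signOf σ * lam)) * logCount P σ (Real.log (signOf σ * lam)) =
      ((ind P lam).toNat : ℝ) / |lam| ^ γ := by
  have h1 : signOf σ * lam = |lam| := by
    rw [← abs_of_pos h, abs_mul, abs_signOf, one_mul]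
  have h2 : signOf σ * (signOf σ * lam) = lam := by cases σ <;> simp [signOf]
  have h3 : 0 < |lam| := h1 ▸ h
  rw [logCount, Real.exp_log h, h2, h1, div_eq_mul_inv, ← Real.rpow_neg h3.le,
    Real.rpow_def_of_pos h3, mul_comm, mul_comm (Real.log |lam|)]

end Counting

end SelfSimilarSL

theorem mainTheorem1 {n : ℕ} (a d β : Fin n → ℝ) (P : ℝ → ℝ) (D : ℝ)
    (hP : SelfSimilarSL.IsSelfSimilar a d β P)
    (hna : ¬ SelfSimilarSL.IsArithmetic a d)
    (hD : SelfSimilarSL.IsPositiveSpectralOrder a d D) :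
    ∃ sPos sNeg : ℝ, 0 ≤ sPos ∧ 0 ≤ sNeg ∧
      (∀ lam : ℝ, SelfSimilarSL.ind P lam ≠ ⊤) ∧
      Tendsto (fun lam : ℝ => ((SelfSimilarSL.ind P lam).toNat : ℝ) / |lam| ^ (D / 2))
        atTop (𝓝 sPos) ∧
      Tendsto (fun lam : ℝ => ((SelfSimilarSL.ind P lam).toNat : ℝ) / |lam| ^ (D / 2))
        atBot (𝓝 sNeg) ∧
      ((∃ k, d k < 0) → sPos = sNeg) ∧
      ((∃ y : SelfSimilarSL.sobolevZero,
          0 < (SelfSimilarSL.genDeriv P (SelfSimilarSL.normSq y)).re) → 0 < sPos) ∧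
      ((∃ y : SelfSimilarSL.sobolevZero,
          (SelfSimilarSL.genDeriv P (SelfSimilarSL.normSq y)).re < 0) → 0 < sNeg) := by
  open SelfSimilarSL in
  have ha := hP.a_pos
  have hγ : 0 < D / 2 := half_pos hD.1
  have hτ : ∀ k, 0 < stepLength a d k := fun k =>
    neg_pos.mpr (Real.log_neg (mul_pos (ha k) (abs_pos.mpr k.2)) (mul_abs_lt_one hP k))
  have hsum : ∑ k, Real.exp (-(D / 2) * stepLength a d k) = 1 := by
    simp only [exp_neg_mul_stepLength ha]
    rw [← hD.2, ← Finset.sum_filter_of_ne (p := fun k => d k ≠ 0),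
      ← Finset.sum_subtype_eq_sum_filter]
    · exact Finset.sum_congr (by ext; simp) fun _ _ => rfl
    · intro k _ h hd
      rw [hd, abs_zero, mul_zero, Real.zero_rpow hγ.ne'] at h
      exact h rfl
  have hna' : ¬ ∃ ν : ℝ, 0 < ν ∧ ∀ k, ∃ m : ℤ, stepLength a d k = m * ν := by
    rintro ⟨ν, hν, h⟩
    refine hna ⟨ν, hν, fun k hk => ?_⟩
    obtain ⟨m, hm⟩ := h ⟨k, hk⟩
    refine ⟨-m, ?_⟩
    rw [stepLength] at hm
    push_cast
    linarith
  have hN0 : ∀ σ t, 0 ≤ logCount P σ t := fun σ t => Nat.cast_nonneg _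
  obtain ⟨lam₀, hlam₀, h0⟩ := exists_ind_eq_zero hP.memLp
  obtain ⟨s, hs, hs'⟩ := exists_tendsto_exp_mul (N := logCount P) (e := stepSign d)
    (t₀ := Real.log lam₀) hγ hτ hsum hna' hN0 (logCount_mono hP) (Nat.cast_nonneg (2 * n))
    (fun σ t ht => by
      rw [logCount, h0, ENat.toNat_zero, Nat.cast_zero]
      rw [abs_mul, abs_signOf, one_mul, abs_of_pos (Real.exp_pos t)]
      exact (Real.le_log_iff_exp_le hlam₀).mp ht)
    (logCount_le hP) (le_logCount hP)
  have hpos : ∀ σ, (∃ y : sobolevZero, 0 < signOf σ * (genDeriv P (normSq y)).re) → 0 < s σ := by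
    rintro σ ⟨y, hy⟩
    obtain ⟨c, hc, t₁, ht₁⟩ := exists_exp_le hγ hτ hsum hN0 (le_logCount hP)
      (exists_one_le_logCount hP hy)
    refine hc.trans_le (ge_of_tendsto (hs σ) ((eventually_ge_atTop t₁).mono fun t ht => ?_))
    have := mul_le_mul_of_nonneg_left (ht₁ t ht) (Real.exp_pos (-(D / 2) * t)).le
    rwa [mul_left_comm, ← Real.exp_add, neg_mul, neg_add_cancel, Real.exp_zero, mul_one,
      ← neg_mul] at this
  have hnonneg : ∀ σ, 0 ≤ s σ := fun σ => ge_of_tendsto' (hs σ) fun t =>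
    mul_nonneg (Real.exp_pos _).le (hN0 σ t)
  refine ⟨s false, s true, hnonneg _, hnonneg _, ind_ne_top hP, ?_, ?_, ?_, ?_, ?_⟩
  · have h1 : Tendsto (fun lam : ℝ => signOf false * lam) atTop atTop := by
      simp only [signOf, Bool.false_eq_true, if_false, one_mul]
      exact tendsto_id
    refine ((hs false).comp (Real.tendsto_log_atTop.comp h1)).congr' ?_
    filter_upwards [h1.eventually_gt_atTop 0] with lam hlam
    exact exp_mul_logCount_eq hlam
  · have h1 : Tendsto (fun lam : ℝ => signOf true * lam) atBot atTop := by
      simpa [signOf] using tendsto_neg_atBot_atTop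
    refine ((hs true).comp (Real.tendsto_log_atTop.comp h1)).congr' ?_
    filter_upwards [h1.eventually_gt_atTop 0] with lam hlam
    exact exp_mul_logCount_eq hlam
  · rintro ⟨k, hk⟩
    exact hs' ⟨⟨k, hk.ne⟩, by simpa [stepSign] using hk⟩
  · rintro ⟨y, hy⟩
    exact hpos false ⟨y, by simpa [signOf] using hy⟩
  · rintro ⟨y, hy⟩
    exact hpos true ⟨y, by simpa [signOf] using hy⟩
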